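/- Let $d\ge 1$, let $\|\cdot\|$ be any norm on $\mathbb{R}^d$, and put $B_r=\{x:\|x\|\le r\}$. Let $K:[0,\infty)\to[0,\infty)$ be bounded and monotonically decreasing with $0<\int_{\mathbb{R}^d}K(\|x\|)\,dx<\infty$, and $\beta$-Hölder continuous for some $\beta\in(0,1]$; let $\gamma>0$. Then there is a constant $C>0$, depending only on $d$, $\|\cdot\|$, $K$, $\beta$ and $\gamma$, such that the following holds. Let $X\subset\mathbb{R}^d$ carry its Borel $\sigma$-algebra, and let $\mathcal C(X)$ be a linear space of bounded measurable functions $g:X\to\mathbb{R}$ with a semi-norm $|||\cdot|||$ such that $|||g|||=0$ for constant $g\in\mathcal C(X)$, and $e^g\in\mathcal C(X)$ with $|||e^g|||\le\|e^g\|_\infty\,|||g|||$ for all $g\in\mathcal C(X)$, where $\|\cdot\|_\infty$ is the supremum norm; put $\|g\|_{\mathcal C}=\|g\|_\infty+|||g|||$. Assume that there is $\varphi:(0,\infty)\to(0,\infty)$ such that for all $h>0$ and $x\in\mathbb{R}^d$ the function $K(\|x-\cdot\|/h)$ on $X$ belongs to $\mathcal C(X)$ and $|||K(\|x-\cdot\|/h)|||\le\varphi(h)$.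 Let $(X_i)_{i\ge1}$ be a stationary $X$-valued process on a probability space $(\Omega,\mathcal A,\mu)$ which is geometrically $\mathcal C$-mixing or geometrically time-reversed $\mathcal C$-mixing with rate $c_0e^{-bn^\gamma}$, where $c_0,b>0$. That is, with $\mathrm{cor}(\psi,\chi)=\int\psi\chi\,d\mu-\int\psi\,d\mu\int\chi\,d\mu$, either $$\mathrm{cor}(\psi,g(X_{k+n}))\le c_0e^{-bn^\gamma}$$ for all $n,k\ge1$, all $g\in\mathcal C(X)$ with $\|g\|_{\mathcal C}\le1$ and all $\sigma(X_1,\dots,X_k)$-measurable $\psi$ with $\int|\psi|\,d\mu\le1$; or $$\mathrm{cor}(g(X_k),\psi)\le c_0e^{-bn^\gamma}$$ for all $n,k\ge1$, all such $g$ and all $\sigma(X_{k+n},X_{k+n+1},\dots)$-measurable $\psi$ with $\int|\psi|\,d\mu\le1$. Suppose that the distribution $P$ of $X_1$ has a Lebesgue density $f$ with essential supremum $\|f\|_\infty<\infty$, and that $P(B_{r_0})=1$ for some $r_0\ge1$. For $h>0$ and a probability measure $Q$ on $\mathbb{R}^d$ put $f_{Q,h}(x)=h^{-d}\int K(\|x-x'\|/h)\,dQ(x')$,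 and let $D=\frac1n\sum_{i=1}^n\delta_{X_i}$. Then for all $0<h\le1$, all $\tau>0$ and all $n\ge n_0^*$, where $$n_0^*=\max\Bigl\{\min\Bigl\{m\in\mathbb{N}: m\ge3,\ m\ge\Bigl(\tfrac{808\,c_0\,(3h^{-d}\varphi(h)+K(0))}{2K(0)}\Bigr)^{\frac1{d+1}},\ \tfrac{m}{(\log m)^{2/\gamma}}\ge4\Bigr\},\ e^{(d+1)/b}\Bigr\},$$ with probability $\mu$ at least $1-e^{-\tau}$ there holds $$\sup_{x\in\mathbb{R}^d}|f_{D,h}(x)-f_{P,h}(x)|\le C\left(\sqrt{\frac{\|f\|_\infty\,(\tau+\log\frac{nr_0}{h})(\log n)^{2/\gamma}}{h^dn}}+\frac{K(0)\,(\tau+\log\frac{nr_0}{h})(\log n)^{2/\gamma}}{h^dn}\right).$$ -/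

import Mathlib

open MeasureTheory Set
open scoped ENNReal NNReal

noncomputable section

/-- The supremum norm `‖g‖_∞ = sup_a |g a|` of a bounded function. It is only used for bounded
functions on non-empty sets. -/
def supNorm {α : Type*} (g : α → ℝ) : ℝ := ⨆ a, |g a|

/-- The norm of `L_∞(λ^d)`, that is, the essential supremum of `|f|` (used when it is finite). -/
def lInftyNorm {d : ℕ} (f : (Fin d → ℝ) → ℝ) : ℝ := (eLpNorm f ∞ volume).toReal

/-! ### The function class `𝒞(X)` and its norm -/

/-- A linear space `𝒞(S)` of bounded measurable functions `S → ℝ`, together with a semi-norm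
on it. -/
structure FunctionClass (S : Type*) [MeasurableSpace S] where
  space : Submodule ℝ (S → ℝ)
  measurable_of_mem : ∀ g ∈ space, Measurable g
  bounded_of_mem : ∀ g ∈ space, ∃ M : ℝ, ∀ s, |g s| ≤ M
  semi : Seminorm ℝ space

/-- The norm `‖g‖_𝒞 = ‖g‖_∞ + |||g|||`. -/
def FunctionClass.cNorm {S : Type*} [MeasurableSpace S] (F : FunctionClass S) (g : F.space) : ℝ :=
  supNorm (g : S → ℝ) + F.semi g

/-- The restrictions on the semi-norm: it vanishes on constant functions, and it satisfies the
abstract chain rule `|||e^g||| ≤ ‖e^g‖_∞ |||g|||` (in particular `e^g` lies in the class, so that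
the left-hand side makes sense). -/
structure FunctionClass.ChainRule {S : Type*} [MeasurableSpace S] (F : FunctionClass S) :
    Prop where
  const : ∀ g : F.space, (∃ a : ℝ, ∀ s, (g : S → ℝ) s = a) → F.semi g = 0
  exp : ∀ g : F.space, ∃ hg : (fun s => Real.exp ((g : S → ℝ) s)) ∈ F.space,
    F.semi ⟨fun s => Real.exp ((g : S → ℝ) s), hg⟩
      ≤ supNorm (fun s => Real.exp ((g : S → ℝ) s)) * F.semi g

/-! ### Stationary `𝒞`-mixing processes

Processes are indexed by the integers `i ≥ 1`; the value at the index `0` is never used. -/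

/-- The closed unit ball of `L_1(𝒜', μ)`, where `𝒜'` is a sub-σ-algebra of the σ-algebra `𝒜` on
which `μ` is defined. -/
def lOneBall {Ω : Type*} (𝒜' : MeasurableSpace Ω) {𝒜 : MeasurableSpace Ω} (μ : Measure[𝒜] Ω) :
    Set (Ω → ℝ) :=
  {ψ | Measurable[𝒜'] ψ ∧ Integrable[𝒜] ψ μ ∧ ∫ ω, |ψ ω| ∂μ ≤ 1}

section Mixing

variable {Ω : Type*} [MeasurableSpace Ω] {S : Type*} [MeasurableSpace S]

/-- The correlation `cor(ψ, χ) = ∫ ψ χ dμ - ∫ ψ dμ ∫ χ dμ`. -/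
def cor (μ : Measure Ω) (ψ χ : Ω → ℝ) : ℝ :=
  (∫ ω, ψ ω * χ ω ∂μ) - (∫ ω, ψ ω ∂μ) * (∫ ω, χ ω ∂μ)

/-- The σ-algebra generated by `X_1, …, X_k`. -/
abbrev pastAlgebra (X : ℕ → Ω → S) (k : ℕ) : MeasurableSpace Ω :=
  ⨆ i ∈ Set.Icc 1 k, MeasurableSpace.comap (X i) inferInstance

/-- The σ-algebra generated by `X_k, X_{k+1}, …`. -/
abbrev futureAlgebra (X : ℕ → Ω → S) (k : ℕ) : MeasurableSpace Ω :=
  ⨆ i ∈ Set.Ici k, MeasurableSpace.comap (X i) inferInstance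

/-- The process `(X_i)_{i ≥ 1}` consists of random variables and is stationary. -/
structure IsStationaryProcess (μ : Measure Ω) (X : ℕ → Ω → S) : Prop where
  measurable : ∀ i, 1 ≤ i → Measurable (X i)
  shift : ∀ (m : ℕ) (idx : Fin m → ℕ), (∀ l, 1 ≤ idx l) → ∀ j : ℕ, 1 ≤ j →
    μ.map (fun ω l => X (idx l + j) ω) = μ.map (fun ω l => X (idx l) ω)

/-- The `𝒞`-mixing coefficient `φ_𝒞(𝒳, n)`. On a probability space the set below contains `0` and
is bounded above by `2`. -/
def mixingCoeff (F : FunctionClass S) (μ : Measure Ω) (X : ℕ → Ω → S) (n : ℕ) : ℝ :=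
  sSup {c | ∃ k : ℕ, 1 ≤ k ∧ ∃ ψ ∈ lOneBall (pastAlgebra X k) μ, ∃ g : F.space,
    F.cNorm g ≤ 1 ∧ c = cor μ ψ (fun ω => (g : S → ℝ) (X (k + n) ω))}

/-- The time-reversed `𝒞`-mixing coefficient `φ_{𝒞,rev}(𝒳, n)`. -/
def mixingCoeffRev (F : FunctionClass S) (μ : Measure Ω) (X : ℕ → Ω → S) (n : ℕ) : ℝ :=
  sSup {c | ∃ k : ℕ, 1 ≤ k ∧ ∃ φ ∈ lOneBall (futureAlgebra X (k + n)) μ, ∃ g : F.space,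
    F.cNorm g ≤ 1 ∧ c = cor μ (fun ω => (g : S → ℝ) (X k ω)) φ}

/-- Geometrically `𝒞`-mixing with rate `c₀ exp(-b n^γ)`. -/
def IsGeomMixing (F : FunctionClass S) (μ : Measure Ω) (X : ℕ → Ω → S) (c₀ b γ : ℝ) : Prop :=
  ∀ n : ℕ, 1 ≤ n → mixingCoeff F μ X n ≤ c₀ * Real.exp (-b * (n : ℝ) ^ γ)

/-- Geometrically time-reversed `𝒞`-mixing with rate `c₀ exp(-b n^γ)`. -/
def IsGeomMixingRev (F : FunctionClass S) (μ : Measure Ω) (X : ℕ → Ω → S) (c₀ b γ : ℝ) : Prop :=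
  ∀ n : ℕ, 1 ≤ n → mixingCoeffRev F μ X n ≤ c₀ * Real.exp (-b * (n : ℝ) ^ γ)

end Mixing

/-! ### Kernels and kernel density estimators on `ℝ^d` with an arbitrary norm `N` -/

section Kernel

variable {d : ℕ}

/-- `K : [0, ∞) → [0, ∞)` is a `d`-dimensional smoothing kernel with respect to the norm `N`. Only
the values of `K` on `[0, ∞)` matter. -/
structure IsSmoothingKernel (N : Seminorm ℝ (Fin d → ℝ)) (K : ℝ → ℝ) : Prop where
  nonneg : ∀ r, 0 ≤ r → 0 ≤ K r
  bounded : ∃ M : ℝ, ∀ r, 0 ≤ r → K r ≤ M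
  antitone : AntitoneOn K (Set.Ici 0)
  integrable : Integrable (fun x : Fin d → ℝ => K (N x)) volume
  integral_pos : 0 < ∫ x : Fin d → ℝ, K (N x)

/-- The functions `K(‖x - ·‖ / h)`, restricted to `S ⊆ ℝ^d`, belong to the class `𝒞(S)`, and their
semi-norms are bounded by `φ(h)` uniformly in `x ∈ ℝ^d`, where `φ : (0, ∞) → (0, ∞)`. -/
def KernelInClass (N : Seminorm ℝ (Fin d → ℝ)) (K : ℝ → ℝ) {S : Set (Fin d → ℝ)}
    (F : FunctionClass S) (φ : ℝ → ℝ) : Prop :=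
  ∀ h : ℝ, 0 < h → 0 < φ h ∧ ∀ x : Fin d → ℝ,
    ∃ hx : (fun y : S => K (N (x - (y : Fin d → ℝ)) / h)) ∈ F.space,
      F.semi ⟨fun y : S => K (N (x - (y : Fin d → ℝ)) / h), hx⟩ ≤ φ h

/-- The `K`-smoothing `f_{Q,h}(x) = h^{-d} ∫ K(‖x - x'‖ / h) dQ(x')` of a measure `Q`. -/
def kSmoothing (N : Seminorm ℝ (Fin d → ℝ)) (K : ℝ → ℝ) (h : ℝ) (Q : Measure (Fin d → ℝ))
    (x : Fin d → ℝ) : ℝ :=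
  (h ^ d)⁻¹ * ∫ x', K (N (x - x') / h) ∂Q

/-- The empirical measure `(1/n) ∑_{i=1}^n δ_{x_i}`. -/
def empiricalMeasure (x : ℕ → Fin d → ℝ) (n : ℕ) : Measure (Fin d → ℝ) :=
  (n : ℝ≥0∞)⁻¹ • ∑ i ∈ Finset.Icc 1 n, Measure.dirac (x i)

/-- The threshold `n₀*`, the maximum of `exp((d+1)/b)` and of the least integer `m ≥ 3` with
`m ≥ (808 c₀ (3 h^{-d} φ(h) + K(0)) / (2 K(0)))^{1/(d+1)}` and `m / (log m)^{2/γ} ≥ 4`. -/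
def nZeroStar (d : ℕ) (c₀ b γ h φh K0 : ℝ) : ℝ :=
  max
    ((sInf {m : ℕ | 3 ≤ m ∧
        (808 * c₀ * (3 * (h ^ d)⁻¹ * φh + K0) / (2 * K0)) ^ (1 / ((d : ℝ) + 1)) ≤ (m : ℝ) ∧
        4 ≤ (m : ℝ) / Real.log m ^ (2 / γ)} : ℕ) : ℝ)
    (Real.exp (((d : ℝ) + 1) / b))

end Kernel

end

/-! A Bernstein inequality for mixing sums is applied at the points of a finite net, and the
kernel's regularity and decay extend the bound to all `x`.

For the Bernstein inequality, fix a gap `k` of order `(log n)^(2/γ)` and split `1, …, n` into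
residue classes mod `k`. Jensen's inequality (`exp_sum_le_average`) reduces the exponential moment
of the full sum to those of the classes. Within a class the indices are `k` apart, and
`integral_prod_le_of_separated` removes the factors `e^{tG(X_i)}` one by one. Each removal costs an
error proportional to the integral of the remaining product, so the errors multiply up harmlessly.
The chain rule controls the `𝒞`-norm of `e^{tG}`, and the threshold on `n` makes the total mixing
error at most 1 (`mixing_remainder_le`). Chernoff's bound then gives `bernstein_of_mixing`, with
effective sample size `n / k`.

For the kernels, `K² ≤ K(0) K` and the bounded density give a second moment of order `‖f‖_∞ h^d`
(`integral_sq_le`). Hölder continuity handles points near the net, and the decay `K(r) ≤ c / r`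
handles points far from the support (`supNorm_kSmoothing_sub_le`). The logarithm of the net size is
`O(log (n r₀ / h))`, so the union bound costs only a constant factor. When `n < k` the claimed bound
already exceeds the trivial one. -/

/-! ### Norms on the function class -/

theorem supNorm_nonneg {α : Type*} (g : α → ℝ) : 0 ≤ supNorm g :=
  Real.iSup_nonneg fun _ => abs_nonneg _

theorem le_supNorm {α : Type*} {g : α → ℝ} (hg : ∃ M : ℝ, ∀ s, |g s| ≤ M) (s : α) :
    |g s| ≤ supNorm g := by
  obtain ⟨M, hM⟩ := hg
  exact le_ciSup (f := fun a => |g a|) ⟨M, by rintro _ ⟨a, rfl⟩; exact hM a⟩ s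

theorem supNorm_le {α : Type*} {g : α → ℝ} {M : ℝ} (hM : 0 ≤ M) (hg : ∀ s, |g s| ≤ M) :
    supNorm g ≤ M :=
  Real.iSup_le hg hM

namespace FunctionClass

variable {S : Type*} [MeasurableSpace S] {F : FunctionClass S}

theorem cNorm_nonneg (g : F.space) : 0 ≤ F.cNorm g :=
  add_nonneg (supNorm_nonneg _) (apply_nonneg _ _)

theorem abs_le_cNorm (g : F.space) (s : S) : |(g : S → ℝ) s| ≤ F.cNorm g :=
  (le_supNorm (F.bounded_of_mem g g.2) s).trans (le_add_of_nonneg_right (apply_nonneg _ _))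

theorem cNorm_smul {c : ℝ} (hc : 0 ≤ c) (g : F.space) : F.cNorm (c • g) = c * F.cNorm g := by
  have : supNorm ((c • g : F.space) : S → ℝ) = c * supNorm (g : S → ℝ) := by
    simp only [supNorm, Submodule.coe_smul, Pi.smul_apply, smul_eq_mul, abs_mul, abs_of_nonneg hc]
    rw [Real.mul_iSup_of_nonneg hc]
  rw [cNorm, cNorm, this, map_smul_eq_mul, Real.norm_of_nonneg hc]
  ring

/-- The chain rule at `g = 0` puts `e^0 = 1` in the space. Constants are needed to centre the kernel
functions. -/
theorem ChainRule.const_mem (hF : F.ChainRule) (a : ℝ) : (fun _ : S => a) ∈ F.space := by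
  obtain ⟨h, -⟩ := hF.exp 0
  convert F.space.smul_mem a h using 1
  ext s
  simp

theorem ChainRule.exp_smul_mem (hF : F.ChainRule) (G : F.space) (t : ℝ) :
    (fun s => Real.exp (t * (G : S → ℝ) s)) ∈ F.space :=
  (hF.exp (t • G)).1

/-- With `|tG| ≤ 1` the factor `‖e^{tG}‖_∞` is at most `e`, so the norm grows only linearly in the
semi-norm bound. -/
theorem ChainRule.cNorm_exp_smul_le (hF : F.ChainRule) (G : F.space) {t A : ℝ} (ht : 0 ≤ t)
    (hA : F.semi G ≤ A) (hB : ∀ s, |t * (G : S → ℝ) s| ≤ 1) :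
    F.cNorm ⟨_, hF.exp_smul_mem G t⟩ ≤ Real.exp 1 * (1 + t * A) := by
  obtain ⟨h, hle⟩ := hF.exp (t • G)
  have h1 : supNorm (fun s => Real.exp (t * (G : S → ℝ) s)) ≤ Real.exp 1 := by
    refine supNorm_le (Real.exp_pos _).le fun s => ?_
    rw [abs_of_pos (Real.exp_pos _)]
    exact Real.exp_le_exp.2 ((le_abs_self _).trans (hB s))
  have h2 : F.semi (t • G) ≤ t * A := by
    rw [map_smul_eq_mul, Real.norm_of_nonneg ht]
    gcongr
  have h3 : F.semi ⟨_, hF.exp_smul_mem G t⟩ ≤ Real.exp 1 * (t * A) :=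
    hle.trans (mul_le_mul h1 h2 (apply_nonneg _ _) (Real.exp_pos _).le)
  calc _ ≤ Real.exp 1 + Real.exp 1 * (t * A) := add_le_add h1 h3
    _ = _ := by ring

end FunctionClass

/-! ### Mixing coefficients and decoupling -/

theorem measurable_pastAlgebra {Ω S : Type*} [MeasurableSpace S] {X : ℕ → Ω → S} {k i : ℕ}
    (h1 : 1 ≤ i) (hi : i ≤ k) :
    Measurable[pastAlgebra X k] (X i) :=
  (comap_measurable (X i)).mono (le_iSup₂_of_le i ⟨h1, hi⟩ le_rfl) le_rfl

theorem measurable_futureAlgebra {Ω S : Type*} [MeasurableSpace S] {X : ℕ → Ω → S}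
    {k i : ℕ} (hi : k ≤ i) :
    Measurable[futureAlgebra X k] (X i) :=
  (comap_measurable (X i)).mono (le_iSup₂_of_le i hi le_rfl) le_rfl

section Mixing

variable {Ω : Type*} [MeasurableSpace Ω] {S : Type*} [MeasurableSpace S]
  {F : FunctionClass S} {μ : Measure Ω} {X : ℕ → Ω → S}

theorem IsStationaryProcess.map_eq (hX : IsStationaryProcess μ X) {i : ℕ} (hi : 1 ≤ i) :
    μ.map (X i) = μ.map (X 1) := by
  rcases hi.eq_or_lt with rfl | hi
  · rfl
  have h := hX.shift 1 (fun _ => 1) (fun _ => le_rfl) (i - 1) (by omega)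
  have h' := congrArg (Measure.map (fun v : Fin 1 → S => v 0)) h
  have hm : ∀ j, 1 ≤ j → Measurable (fun ω => fun _ : Fin 1 => X j ω) := fun j hj =>
    measurable_pi_lambda _ fun _ => hX.measurable j hj
  rw [Measure.map_map (measurable_pi_apply 0) (hm _ (by omega)),
    Measure.map_map (measurable_pi_apply 0) (hm 1 le_rfl)] at h'
  have e : 1 + (i - 1) = i := by omega
  simpa [Function.comp_def, e] using h'

theorem IsStationaryProcess.integral_comp_eq (hX : IsStationaryProcess μ X) {i : ℕ} (hi : 1 ≤ i)
    {u : S → ℝ} (hu : Measurable u) : ∫ ω, u (X i ω) ∂μ = ∫ ω, u (X 1 ω) ∂μ := by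
  rw [← integral_map (hX.measurable i hi).aemeasurable hu.aestronglyMeasurable,
    ← integral_map (hX.measurable 1 le_rfl).aemeasurable hu.aestronglyMeasurable, hX.map_eq hi]

/-- This bounds the sets defining the mixing coefficients; the real `sSup` of an unbounded set would
be the default value 0. -/
theorem abs_cor_le_two [IsProbabilityMeasure μ] {ψ χ : Ω → ℝ} (hψ : Integrable ψ μ)
    (h1 : ∫ ω, |ψ ω| ∂μ ≤ 1) (hχ : ∀ ω, |χ ω| ≤ 1) :
    |cor μ ψ χ| ≤ 2 := by
  have a1 : |∫ ω, ψ ω * χ ω ∂μ| ≤ 1 := by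
    refine (abs_integral_le_integral_abs).trans (le_trans ?_ h1)
    refine integral_mono_of_nonneg (Filter.Eventually.of_forall fun _ => abs_nonneg _) hψ.abs
      (Filter.Eventually.of_forall fun ω => ?_)
    simp only [abs_mul]
    exact mul_le_of_le_one_right (abs_nonneg _) (hχ ω)
  have a2 : |∫ ω, ψ ω ∂μ| ≤ 1 := abs_integral_le_integral_abs.trans h1
  have a3 : |∫ ω, χ ω ∂μ| ≤ 1 := by
    have := norm_integral_le_of_norm_le_const (μ := μ) (f := χ) (C := 1)
      (Filter.Eventually.of_forall hχ)
    simpa using this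
  calc |cor μ ψ χ| ≤ |∫ ω, ψ ω * χ ω ∂μ| + |(∫ ω, ψ ω ∂μ) * ∫ ω, χ ω ∂μ| := abs_sub _ _
    _ ≤ 1 + 1 * 1 := by
        rw [abs_mul]
        gcongr
    _ = 2 := by norm_num

theorem cor_comm (ψ χ : Ω → ℝ) : cor μ ψ χ = cor μ χ ψ := by
  simp only [cor, mul_comm]

theorem cor_smul_smul (a b : ℝ) (ψ χ : Ω → ℝ) :
    cor μ (fun ω => a * ψ ω) (fun ω => b * χ ω) = a * b * cor μ ψ χ := by
  have : ∀ ω, a * ψ ω * (b * χ ω) = a * b * (ψ ω * χ ω) := fun ω => by ring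
  simp only [cor, this, integral_const_mul]
  ring

theorem cor_le_mixingCoeff [IsProbabilityMeasure μ] {k n : ℕ} (hk : 1 ≤ k)
    {ψ : Ω → ℝ} (hψ : ψ ∈ lOneBall (pastAlgebra X k) μ)
    {g : F.space} (hg : F.cNorm g ≤ 1) :
    cor μ ψ (fun ω => (g : S → ℝ) (X (k + n) ω)) ≤ mixingCoeff F μ X n := by
  refine le_csSup ⟨2, ?_⟩ ⟨k, hk, ψ, hψ, g, hg, rfl⟩
  rintro _ ⟨k, hk, ψ, hψ, g, hg, rfl⟩
  exact (le_abs_self _).trans (abs_cor_le_two hψ.2.1 hψ.2.2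
    fun ω => (F.abs_le_cNorm g _).trans hg)

theorem cor_le_mixingCoeffRev [IsProbabilityMeasure μ] {k n : ℕ} (hk : 1 ≤ k)
    {ψ : Ω → ℝ} (hψ : ψ ∈ lOneBall (futureAlgebra X (k + n)) μ)
    {g : F.space} (hg : F.cNorm g ≤ 1) :
    cor μ (fun ω => (g : S → ℝ) (X k ω)) ψ ≤ mixingCoeffRev F μ X n := by
  refine le_csSup ⟨2, ?_⟩ ⟨k, hk, ψ, hψ, g, hg, rfl⟩
  rintro _ ⟨k, hk, ψ, hψ, g, hg, rfl⟩
  rw [cor_comm]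
  exact (le_abs_self _).trans (abs_cor_le_two hψ.2.1 hψ.2.2
    fun ω => (F.abs_le_cNorm g _).trans hg)

theorem mixing_rate_nonneg [IsProbabilityMeasure μ] {k : ℕ} {ρ : ℝ}
    (hρ : mixingCoeff F μ X k ≤ ρ ∨ mixingCoeffRev F μ X k ≤ ρ) : 0 ≤ ρ := by
  have h0 : F.cNorm 0 ≤ 1 := by simp [FunctionClass.cNorm, supNorm]
  rcases hρ with h | h
  · refine le_trans ?_ h
    simpa [cor] using cor_le_mixingCoeff (F := F) (X := X) (μ := μ) (n := k) (k := 1) le_rfl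
      (ψ := fun _ => 0) ⟨measurable_const, by simp, by simp⟩ h0
  · refine le_trans ?_ h
    simpa [cor] using cor_le_mixingCoeffRev (F := F) (X := X) (μ := μ) (n := k) (k := 1) le_rfl
      (ψ := fun _ => 0) ⟨measurable_const, by simp, by simp⟩ h0

theorem smul_mem_lOneBall {𝒜 : MeasurableSpace Ω} {ψ : Ω → ℝ} (hψ : Measurable[𝒜] ψ)
    (hi : Integrable ψ μ) (hp : ∀ ω, 0 ≤ ψ ω) (h0 : 0 < ∫ ω, ψ ω ∂μ) :
    (fun ω => (∫ ω, ψ ω ∂μ)⁻¹ * ψ ω) ∈ lOneBall 𝒜 μ := by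
  refine ⟨hψ.const_mul _, hi.const_mul _, le_of_eq ?_⟩
  have : ∀ ω, |(∫ ω, ψ ω ∂μ)⁻¹ * ψ ω| = (∫ ω, ψ ω ∂μ)⁻¹ * ψ ω := fun ω =>
    abs_of_nonneg (mul_nonneg (inv_nonneg.2 h0.le) (hp ω))
  simp only [this, integral_const_mul]
  exact inv_mul_cancel₀ h0.ne'

theorem cNorm_inv_smul {g : F.space} (h0 : 0 < F.cNorm g) :
    F.cNorm ((F.cNorm g)⁻¹ • g) = 1 := by
  rw [FunctionClass.cNorm_smul (inv_nonneg.2 h0.le), inv_mul_cancel₀ h0.ne']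

/-- Normalising `ψ` by its own integral `P` makes the mixing error proportional to `P`. This
multiplicative form is what allows iteration. -/
theorem integral_mul_le_of_cor_le {ψ χ : Ω → ℝ} {P N ρ : ℝ} (hP : ∫ ω, ψ ω ∂μ = P)
    (hP0 : 0 < P) (hN : 0 < N) (h : cor μ (fun ω => P⁻¹ * ψ ω) (fun ω => N⁻¹ * χ ω) ≤ ρ) :
    ∫ ω, ψ ω * χ ω ∂μ ≤ P * (∫ ω, χ ω ∂μ + N * ρ) := by
  rw [cor_smul_smul, cor, hP, ← mul_inv, inv_mul_le_iff₀ (mul_pos hP0 hN)] at h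
  linarith

/-- The decoupling inequality behind the exponential moment bound. -/
theorem integral_prod_le_of_separated [IsProbabilityMeasure μ] (hX : IsStationaryProcess μ X)
    {k : ℕ} {ρ : ℝ} (hρ : mixingCoeff F μ X k ≤ ρ ∨ mixingCoeffRev F μ X k ≤ ρ)
    (u : F.space) (hu : ∀ s, 0 < (u : S → ℝ) s) (I : Finset ℕ) (hI : ∀ i ∈ I, 1 ≤ i)
    (hsep : ∀ i ∈ I, ∀ j ∈ I, i < j → i + k ≤ j) :
    ∫ ω, ∏ i ∈ I, (u : S → ℝ) (X i ω) ∂μ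
      ≤ (∫ ω, (u : S → ℝ) (X 1 ω) ∂μ + F.cNorm u * ρ) ^ I.card := by
  have hum := F.measurable_of_mem u u.2
  have hint : ∀ J : Finset ℕ, (∀ i ∈ J, 1 ≤ i) →
      Integrable (fun ω => ∏ i ∈ J, (u : S → ℝ) (X i ω)) μ := fun J hJ => by
    refine Integrable.of_bound (C := ∏ i ∈ J, F.cNorm u) (Finset.measurable_fun_prod _ fun i hi =>
      hum.comp (hX.measurable i (hJ i hi))).aestronglyMeasurable
      (Filter.Eventually.of_forall fun ω => ?_)
    rw [Real.norm_eq_abs, Finset.abs_prod]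
    exact Finset.prod_le_prod (fun _ _ => abs_nonneg _) fun i _ => F.abs_le_cNorm u _
  have hpos : ∀ J : Finset ℕ, (∀ i ∈ J, 1 ≤ i) →
      0 < ∫ ω, ∏ i ∈ J, (u : S → ℝ) (X i ω) ∂μ := fun J hJ => by
    rw [integral_pos_iff_support_of_nonneg (fun ω => (Finset.prod_pos fun i _ => hu _).le)
      (hint J hJ)]
    have : Function.support (fun ω => ∏ i ∈ J, (u : S → ℝ) (X i ω)) = univ :=
      eq_univ_of_forall fun ω => (Finset.prod_pos fun i _ => hu _).ne'
    rw [this]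
    simp
  have hN : 0 < F.cNorm u := by
    obtain ⟨ω⟩ : Nonempty Ω := μ.nonempty_of_neZero
    exact (abs_pos.2 (hu (X 1 ω)).ne').trans_le (F.abs_le_cNorm u _)
  have key : ∀ (a : ℕ) (J : Finset ℕ), a ∉ J → J.Nonempty → (∀ i ∈ insert a J, 1 ≤ i) →
      (∫ ω, (∏ i ∈ J, (u : S → ℝ) (X i ω)) * (u : S → ℝ) (X a ω) ∂μ
        ≤ (∫ ω, ∏ i ∈ J, (u : S → ℝ) (X i ω) ∂μ)
          * (∫ ω, (u : S → ℝ) (X 1 ω) ∂μ + F.cNorm u * ρ)) →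
      (∫ ω, ∏ i ∈ J, (u : S → ℝ) (X i ω) ∂μ
        ≤ (∫ ω, (u : S → ℝ) (X 1 ω) ∂μ + F.cNorm u * ρ) ^ J.card) →
      ∫ ω, ∏ i ∈ insert a J, (u : S → ℝ) (X i ω) ∂μ
        ≤ (∫ ω, (u : S → ℝ) (X 1 ω) ∂μ + F.cNorm u * ρ) ^ (insert a J).card := by
    intro a J ha hne h1 hstep ih
    have e : ∀ ω, ∏ i ∈ insert a J, (u : S → ℝ) (X i ω)
        = (∏ i ∈ J, (u : S → ℝ) (X i ω)) * (u : S → ℝ) (X a ω) := fun ω => by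
      rw [Finset.prod_insert ha, mul_comm]
    rw [Finset.card_insert_of_notMem ha, pow_succ]
    simp only [e]
    refine hstep.trans (mul_le_mul_of_nonneg_right ih ?_)
    have h0 := hpos J fun i hi => h1 i (Finset.mem_insert_of_mem hi)
    have h2 := hpos (insert a J) h1
    simp only [e] at h2
    exact (pos_of_mul_pos_right (h2.trans_le hstep) h0.le).le
  have hρ0 : 0 ≤ ρ := mixing_rate_nonneg hρ
  -- Singletons need stationarity only. They are kept apart because without an earlier index the
  -- time `a - k` could be 0, where mixing gives nothing.
  have single : ∀ a, 1 ≤ a → ∫ ω, ∏ i ∈ ({a} : Finset ℕ), (u : S → ℝ) (X i ω) ∂μ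
      ≤ (∫ ω, (u : S → ℝ) (X 1 ω) ∂μ + F.cNorm u * ρ) ^ ({a} : Finset ℕ).card := fun a ha => by
    simp only [Finset.prod_singleton, Finset.card_singleton, pow_one]
    rw [hX.integral_comp_eq ha hum]
    exact le_add_of_nonneg_right (mul_nonneg hN.le hρ0)
  rcases hρ with hρ | hρ
  -- Forward mixing: split off the latest factor; the others are measurable with respect to the past
  -- up to `a - k`.
  · induction I using Finset.induction_on_max with
    | empty => simp
    | insert a J hlt ih =>
      have hJ1 : ∀ i ∈ J, 1 ≤ i := fun i hi => hI i (Finset.mem_insert_of_mem hi)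
      have ha1 : 1 ≤ a := hI a (Finset.mem_insert_self _ _)
      have ha : a ∉ J := fun h => lt_irrefl _ (hlt a h)
      rcases J.eq_empty_or_nonempty with rfl | hne
      · exact single a ha1
      have hJa : ∀ i ∈ J, i + k ≤ a := fun i hi => hsep i (Finset.mem_insert_of_mem hi) a
        (Finset.mem_insert_self _ _) (hlt i hi)
      refine key a J ha hne hI ?_ (ih hJ1 fun i hi j hj =>
        hsep i (Finset.mem_insert_of_mem hi) j (Finset.mem_insert_of_mem hj))
      rw [← hX.integral_comp_eq ha1 hum]
      refine integral_mul_le_of_cor_le rfl (hpos J hJ1) hN (le_trans ?_ hρ)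
      obtain ⟨j, hj⟩ := hne
      have hak : a - k + k = a := Nat.sub_add_cancel (by have := hJa j hj; omega)
      have hk1 : 1 ≤ a - k := by have := hJa j hj; have := hJ1 j hj; omega
      have := cor_le_mixingCoeff (F := F) (X := X) (μ := μ) (n := k) hk1
        (smul_mem_lOneBall (μ := μ) (𝒜 := pastAlgebra X (a - k))
          (ψ := fun ω => ∏ i ∈ J, (u : S → ℝ) (X i ω))
          (Finset.measurable_fun_prod _ fun i hi => hum.comp
            (measurable_pastAlgebra (hJ1 i hi) (by have := hJa i hi; omega)))
          (hint J hJ1) (fun ω => (Finset.prod_pos fun i _ => hu _).le) (hpos J hJ1))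
        (cNorm_inv_smul hN).le
      rw [hak] at this
      exact this
  -- Time-reversed mixing: split off the earliest factor; the others are measurable with respect to
  -- the future from `a + k`.
  · induction I using Finset.induction_on_min with
    | empty => simp
    | insert a J hlt ih =>
      have hJ1 : ∀ i ∈ J, 1 ≤ i := fun i hi => hI i (Finset.mem_insert_of_mem hi)
      have ha1 : 1 ≤ a := hI a (Finset.mem_insert_self _ _)
      have ha : a ∉ J := fun h => lt_irrefl _ (hlt a h)
      rcases J.eq_empty_or_nonempty with rfl | hne
      · exact single a ha1
      have hJa : ∀ i ∈ J, a + k ≤ i := fun i hi => hsep a (Finset.mem_insert_self _ _) i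
        (Finset.mem_insert_of_mem hi) (hlt i hi)
      refine key a J ha hne hI ?_ (ih hJ1 fun i hi j hj =>
        hsep i (Finset.mem_insert_of_mem hi) j (Finset.mem_insert_of_mem hj))
      rw [← hX.integral_comp_eq ha1 hum]
      refine integral_mul_le_of_cor_le rfl (hpos J hJ1) hN (le_trans ?_ hρ)
      rw [cor_comm]
      exact cor_le_mixingCoeffRev (F := F) (X := X) (μ := μ) (n := k) ha1
        (smul_mem_lOneBall (μ := μ) (𝒜 := futureAlgebra X (a + k))
          (ψ := fun ω => ∏ i ∈ J, (u : S → ℝ) (X i ω))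
          (Finset.measurable_fun_prod _ fun i hi => hum.comp
            (measurable_futureAlgebra (hJa i hi)))
          (hint J hJ1) (fun ω => (Finset.prod_pos fun i _ => hu _).le) (hpos J hJ1))
        (cNorm_inv_smul hN).le

end Mixing

/-! ### Exponential moments and the Bernstein inequality -/

section Bernstein

variable {Ω : Type*} [MeasurableSpace Ω] {S : Type*} [MeasurableSpace S]
  {F : FunctionClass S} {μ : Measure Ω} {X : ℕ → Ω → S}

theorem exp_le_one_add_add_sq {x : ℝ} (hx : |x| ≤ 1) : Real.exp x ≤ 1 + x + x ^ 2 := by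
  have := (abs_le.1 (Real.abs_exp_sub_one_sub_id_le hx)).2
  linarith

/-- Integrate `e^x ≤ 1 + x + x²`, valid for `|x| ≤ 1`; centring removes the linear term. -/
theorem integral_exp_mul_le [IsProbabilityMeasure μ] {Y : Ω → ℝ} (hY : Measurable Y) {B V t : ℝ}
    (hB : ∀ ω, |Y ω| ≤ B) (h0 : ∫ ω, Y ω ∂μ = 0) (hV : ∫ ω, Y ω ^ 2 ∂μ ≤ V)
    (ht : ∀ ω, |t * Y ω| ≤ 1) : ∫ ω, Real.exp (t * Y ω) ∂μ ≤ 1 + t ^ 2 * V := by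
  have hi : Integrable Y μ := Integrable.of_bound hY.aestronglyMeasurable B
    (Filter.Eventually.of_forall hB)
  have hi2 : Integrable (fun ω => Y ω ^ 2) μ :=
    Integrable.of_bound (hY.pow_const 2).aestronglyMeasurable (B ^ 2)
      (Filter.Eventually.of_forall fun ω => by
        rw [Real.norm_eq_abs, abs_pow]
        exact pow_le_pow_left₀ (abs_nonneg _) (hB ω) 2)
  calc ∫ ω, Real.exp (t * Y ω) ∂μ ≤ ∫ ω, (1 + t * Y ω + t ^ 2 * Y ω ^ 2) ∂μ := by
        refine integral_mono_of_nonneg (Filter.Eventually.of_forall fun _ => (Real.exp_pos _).le)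
          (((integrable_const _).add (hi.const_mul t)).add (hi2.const_mul _))
          (Filter.Eventually.of_forall fun ω => ?_)
        have := exp_le_one_add_add_sq (ht ω)
        simpa [mul_pow] using this
    _ = 1 + t ^ 2 * ∫ ω, Y ω ^ 2 ∂μ := by
        have i1 : Integrable (fun ω => 1 + t * Y ω) μ := (integrable_const _).add (hi.const_mul t)
        rw [integral_add i1 (hi2.const_mul _), integral_add (integrable_const _) (hi.const_mul t),
          integral_const_mul, integral_const_mul, h0]
        simp
    _ ≤ _ := by gcongr

/-- Decoupling with `u = e^{tG}` bounds each factor by one plus a small quantity, and `1 + x ≤ e^x`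
makes the power an exponential. -/
theorem integral_exp_sum_le_of_separated [IsProbabilityMeasure μ] (hF : F.ChainRule)
    (hX : IsStationaryProcess μ X) {k : ℕ} {ρ : ℝ}
    (hρ : mixingCoeff F μ X k ≤ ρ ∨ mixingCoeffRev F μ X k ≤ ρ)
    (G : F.space) {A B V t : ℝ} (hA : F.semi G ≤ A) (hB : ∀ s, |(G : S → ℝ) s| ≤ B)
    (h0 : ∫ ω, (G : S → ℝ) (X 1 ω) ∂μ = 0) (hV : ∫ ω, (G : S → ℝ) (X 1 ω) ^ 2 ∂μ ≤ V)
    (ht : 0 ≤ t) (htB : t * B ≤ 1) (I : Finset ℕ) (hI : ∀ i ∈ I, 1 ≤ i)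
    (hsep : ∀ i ∈ I, ∀ j ∈ I, i < j → i + k ≤ j) :
    ∫ ω, Real.exp (t * ∑ i ∈ I, (G : S → ℝ) (X i ω)) ∂μ
      ≤ Real.exp (I.card * (t ^ 2 * V + Real.exp 1 * (1 + t * A) * ρ)) := by
  have htG : ∀ s, |t * (G : S → ℝ) s| ≤ 1 := fun s => by
    rw [abs_mul, abs_of_nonneg ht]
    exact (mul_le_mul_of_nonneg_left (hB s) ht).trans htB
  have h := integral_prod_le_of_separated hX hρ ⟨_, hF.exp_smul_mem G t⟩
    (fun _ => Real.exp_pos _) I hI hsep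
  simp only [← Real.exp_sum, ← Finset.mul_sum] at h
  have hm := integral_exp_mul_le (μ := μ) (t := t)
    ((F.measurable_of_mem G G.2).comp (hX.measurable 1 le_rfl)) (fun ω => hB _) h0 hV
    (fun ω => htG _)
  have hc := hF.cNorm_exp_smul_le G ht hA htG
  have hρ0 := mixing_rate_nonneg hρ
  refine h.trans ?_
  rw [Real.exp_nat_mul]
  refine pow_le_pow_left₀ (add_nonneg (integral_nonneg fun _ => (Real.exp_pos _).le)
    (mul_nonneg (F.cNorm_nonneg _) hρ0)) ?_ _
  calc _ ≤ (1 + t ^ 2 * V) + Real.exp 1 * (1 + t * A) * ρ :=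
        add_le_add hm (mul_le_mul_of_nonneg_right hc hρ0)
    _ = (t ^ 2 * V + Real.exp 1 * (1 + t * A) * ρ) + 1 := by ring
    _ ≤ _ := Real.add_one_le_exp _

theorem card_filter_mod_le (n k r : ℕ) :
    ((Finset.Icc 1 n).filter fun i => i % k = r).card ≤ n / k + 1 := by
  rw [← Finset.card_range (n / k + 1)]
  refine Finset.card_le_card_of_injOn (fun i => i / k) (fun i hi => ?_) fun i hi j hj hij => ?_
  · simp only [Finset.coe_filter, Finset.mem_Icc, mem_ofPred_eq] at hi
    simp only [Finset.coe_range, mem_Iio]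
    exact Nat.lt_succ_of_le (Nat.div_le_div_right hi.1.2)
  · simp only [Finset.coe_filter, Finset.mem_Icc, mem_ofPred_eq] at hi hj
    rw [← Nat.div_add_mod i k, ← Nat.div_add_mod j k, hi.2, hj.2]
    simp only at hij
    rw [hij]

theorem add_le_of_mod_eq {i j k : ℕ} (h : i % k = j % k) (hij : i < j) : i + k ≤ j := by
  have h1 := (Nat.modEq_iff_dvd' hij.le).1 h
  have := Nat.le_of_dvd (by omega) h1
  omega

/-- Jensen's inequality with equal weights `1 / k`. The factor `k` in the exponent is the price of
dependence. -/
theorem exp_sum_le_average {k : ℕ} (hk : 0 < k) (s : ℝ) (y : ℕ → ℝ) :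
    Real.exp (s * ∑ r ∈ Finset.range k, y r)
      ≤ ∑ r ∈ Finset.range k, (k : ℝ)⁻¹ * Real.exp (s * k * y r) := by
  have hk' : (k : ℝ) ≠ 0 := by positivity
  have := convexOn_exp.map_sum_le (t := Finset.range k) (w := fun _ => (k : ℝ)⁻¹)
    (p := fun r => s * k * y r) (fun _ _ => by positivity) (by simp [hk']) (fun _ _ => mem_univ _)
  simp only [smul_eq_mul] at this
  refine le_of_eq_of_le (congrArg Real.exp ?_) this
  rw [Finset.mul_sum]
  refine Finset.sum_congr rfl fun r _ => ?_
  field_simp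

theorem integral_exp_sum_le [IsProbabilityMeasure μ] (hF : F.ChainRule)
    (hX : IsStationaryProcess μ X) {k : ℕ} {ρ : ℝ}
    (hρ : mixingCoeff F μ X k ≤ ρ ∨ mixingCoeffRev F μ X k ≤ ρ)
    (G : F.space) {A B V s : ℝ} (hA : F.semi G ≤ A) (hBpos : 0 < B)
    (hB : ∀ x, |(G : S → ℝ) x| ≤ B)
    (h0 : ∫ ω, (G : S → ℝ) (X 1 ω) ∂μ = 0) (hV : ∫ ω, (G : S → ℝ) (X 1 ω) ^ 2 ∂μ ≤ V)
    (hs : 0 ≤ s) (hk : 1 ≤ k) (hsB : s * k * B ≤ 1) {n : ℕ} (hkn : k ≤ n) :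
    ∫ ω, Real.exp (s * ∑ i ∈ Finset.Icc 1 n, (G : S → ℝ) (X i ω)) ∂μ
      ≤ Real.exp (2 * n * k * s ^ 2 * V + 2 * n * (Real.exp 1 * (1 + A / B) * ρ)) := by
  have hGm := F.measurable_of_mem G G.2
  have hρ0 := mixing_rate_nonneg hρ
  have hA0 : 0 ≤ A := (apply_nonneg _ _).trans hA
  have hV0 : 0 ≤ V := (integral_nonneg fun _ => sq_nonneg _).trans hV
  have hk0 : (0 : ℝ) < k := by positivity
  set t : ℝ := s * k with htdef
  have ht : 0 ≤ t := by positivity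
  have htA : t * A ≤ A / B := by
    rw [le_div_iff₀ hBpos]
    nlinarith
  set I : ℕ → Finset ℕ := fun r => (Finset.Icc 1 n).filter fun i => i % k = r with hIdef
  have hsum : ∀ ω, ∑ i ∈ Finset.Icc 1 n, (G : S → ℝ) (X i ω)
      = ∑ r ∈ Finset.range k, ∑ i ∈ I r, (G : S → ℝ) (X i ω) := fun ω =>
    (Finset.sum_fiberwise_of_maps_to (fun i _ => Finset.mem_range.2 (Nat.mod_lt i hk)) _).symm
  have hclass : ∀ r, ∫ ω, Real.exp (t * ∑ i ∈ I r, (G : S → ℝ) (X i ω)) ∂μ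
      ≤ Real.exp (2 * n * k * s ^ 2 * V + 2 * n * (Real.exp 1 * (1 + A / B) * ρ)) := fun r => by
    refine (integral_exp_sum_le_of_separated hF hX hρ G hA hB h0 hV ht hsB (I r)
      (fun i hi => (Finset.mem_Icc.1 (Finset.mem_filter.1 hi).1).1)
      (fun i hi j hj hij => add_le_of_mod_eq
        ((Finset.mem_filter.1 hi).2.trans (Finset.mem_filter.1 hj).2.symm) hij)).trans ?_
    refine Real.exp_le_exp.2 ?_
    -- The bound `n / k + 1 ≤ 2n / k` is where `k ≤ n` enters.
    have hc : ((I r).card : ℝ) ≤ 2 * n / k := by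
      have h1 : ((I r).card : ℝ) ≤ ((n / k : ℕ) : ℝ) + 1 := by
        exact_mod_cast card_filter_mod_le n k r
      have h2 : ((n / k : ℕ) : ℝ) ≤ n / k := Nat.cast_div_le
      have h3 : (1 : ℝ) ≤ n / k := by
        rw [le_div_iff₀ hk0, one_mul]
        exact_mod_cast hkn
      rw [mul_div_assoc]
      linarith
    have hc' : ((I r).card : ℝ) ≤ 2 * n := hc.trans (div_le_self (by positivity)
      (by exact_mod_cast hk))
    calc ((I r).card : ℝ) * (t ^ 2 * V + Real.exp 1 * (1 + t * A) * ρ)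
        = (I r).card * (t ^ 2 * V) + (I r).card * (Real.exp 1 * (1 + t * A) * ρ) := by ring
      _ ≤ 2 * n / k * (t ^ 2 * V) + 2 * n * (Real.exp 1 * (1 + A / B) * ρ) := by gcongr
      _ = _ := by
        rw [htdef]
        field_simp
  have hint : ∀ r, Integrable (fun ω => Real.exp (t * ∑ i ∈ I r, (G : S → ℝ) (X i ω))) μ :=
    fun r => by
      refine Integrable.of_bound (C := Real.exp (t * ∑ i ∈ I r, B))
        (Real.measurable_exp.comp ((Finset.measurable_fun_sum _ fun i hi => hGm.comp
          (hX.measurable i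
            (Finset.mem_Icc.1 (Finset.mem_filter.1 hi).1).1)).const_mul t)).aestronglyMeasurable
        (Filter.Eventually.of_forall fun ω => ?_)
      rw [Real.norm_eq_abs, Real.abs_exp]
      refine Real.exp_le_exp.2 (mul_le_mul_of_nonneg_left ?_ ht)
      exact Finset.sum_le_sum fun i _ => (le_abs_self _).trans (hB _)
  calc _ ≤ ∫ ω, ∑ r ∈ Finset.range k, (k : ℝ)⁻¹ * Real.exp (t * ∑ i ∈ I r, (G : S → ℝ) (X i ω)) ∂μ := by
        refine integral_mono_of_nonneg (Filter.Eventually.of_forall fun _ => (Real.exp_pos _).le)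
          (integrable_finsetSum _ fun r _ => (hint r).const_mul _)
          (Filter.Eventually.of_forall fun ω => ?_)
        simp only [hsum]
        exact exp_sum_le_average hk s _
    _ = ∑ r ∈ Finset.range k, (k : ℝ)⁻¹ * ∫ ω, Real.exp (t * ∑ i ∈ I r, (G : S → ℝ) (X i ω)) ∂μ := by
        rw [integral_finsetSum _ fun r _ => (hint r).const_mul _]
        simp only [integral_const_mul]
    _ ≤ ∑ r ∈ Finset.range k, (k : ℝ)⁻¹
          * Real.exp (2 * n * k * s ^ 2 * V + 2 * n * (Real.exp 1 * (1 + A / B) * ρ)) := by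
        gcongr with r hr
        exact hclass r
    _ = _ := by
        rw [Finset.sum_const, Finset.card_range, nsmul_eq_mul, ← mul_assoc,
          mul_inv_cancel₀ hk0.ne', one_mul]

/-- A Bernstein inequality for sums along a stationary `𝒞`-mixing process. -/
theorem bernstein_of_mixing [IsProbabilityMeasure μ] (hF : F.ChainRule)
    (hX : IsStationaryProcess μ X) {k : ℕ} {ρ : ℝ}
    (hρ : mixingCoeff F μ X k ≤ ρ ∨ mixingCoeffRev F μ X k ≤ ρ)
    (G : F.space) {A B V T : ℝ} (hA : F.semi G ≤ A) (hBpos : 0 < B)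
    (hB : ∀ x, |(G : S → ℝ) x| ≤ B)
    (h0 : ∫ ω, (G : S → ℝ) (X 1 ω) ∂μ = 0) (hV : ∫ ω, (G : S → ℝ) (X 1 ω) ^ 2 ∂μ ≤ V)
    (hT : 0 < T) (hk : 1 ≤ k) {n : ℕ} (hkn : k ≤ n)
    (hη : 2 * n * (Real.exp 1 * (1 + A / B) * ρ) ≤ 1) :
    μ.real {ω | 2 * (T * k * B + Real.sqrt (2 * n * k * V * T))
        ≤ ∑ i ∈ Finset.Icc 1 n, (G : S → ℝ) (X i ω)} ≤ Real.exp (1 - T) := by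
  have hGm := F.measurable_of_mem G G.2
  have hV0 : 0 ≤ V := (integral_nonneg fun _ => sq_nonneg _).trans hV
  have hk0 : (0 : ℝ) < k := by positivity
  set q := Real.sqrt (2 * n * k * V * T) with hq
  have hq0 : 0 ≤ q := Real.sqrt_nonneg _
  have hq2 : q ^ 2 = 2 * n * k * V * T := Real.sq_sqrt (by positivity)
  have hD : 0 < T * k * B + q := by positivity
  -- This Chernoff parameter keeps `s k B ≤ 1` and the variance term at most `T`, while `s` times
  -- the deviation level is exactly `2T`. The final exponent is thus `-2T + T + 1`.
  set s := T / (T * k * B + q) with hsdef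
  have hs : 0 ≤ s := by positivity
  have hsB : s * k * B ≤ 1 := by
    have : s * k * B = (T * k * B) / (T * k * B + q) := by rw [hsdef]; ring
    rw [this, div_le_one hD]
    linarith
  have hsV : 2 * n * k * s ^ 2 * V ≤ T := by
    have : 2 * n * k * s ^ 2 * V = T * (q ^ 2 / (T * k * B + q) ^ 2) := by
      rw [hq2, hsdef, div_pow]; ring
    rw [this]
    refine mul_le_of_le_one_right hT.le ?_
    rw [div_le_one (by positivity)]
    have : 0 ≤ T * k * B := by positivity
    gcongr
    linarith
  have hm : Measurable fun ω => ∑ i ∈ Finset.Icc 1 n, (G : S → ℝ) (X i ω) :=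
    Finset.measurable_fun_sum _ fun i hi => hGm.comp (hX.measurable i (Finset.mem_Icc.1 hi).1)
  have hint : Integrable (fun ω => Real.exp (s * ∑ i ∈ Finset.Icc 1 n, (G : S → ℝ) (X i ω))) μ := by
    refine Integrable.of_bound (C := Real.exp (s * ∑ i ∈ Finset.Icc 1 n, B))
      (Real.measurable_exp.comp (hm.const_mul s)).aestronglyMeasurable
      (Filter.Eventually.of_forall fun ω => ?_)
    rw [Real.norm_eq_abs, Real.abs_exp]
    refine Real.exp_le_exp.2 (mul_le_mul_of_nonneg_left ?_ hs)
    exact Finset.sum_le_sum fun i _ => (le_abs_self _).trans (hB _)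
  refine (ProbabilityTheory.measure_ge_le_exp_mul_mgf _ hs hint).trans ?_
  have hE := integral_exp_sum_le hF hX hρ G hA hBpos hB h0 hV hs hk hsB hkn
  have hsD : s * (2 * (T * k * B + q)) = 2 * T := by
    rw [hsdef]; field_simp
  calc _ ≤ Real.exp (-(2 * T)) * Real.exp (T + 1) := by
        rw [neg_mul, hsD]
        refine mul_le_mul_of_nonneg_left (hE.trans (Real.exp_le_exp.2 ?_)) (Real.exp_pos _).le
        linarith
    _ = _ := by
        rw [← Real.exp_add]
        ring_nf

/-- Subtracting the mean `m` does not increase the semi-norm, since constants have semi-norm 0. It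
keeps `|g - m| ≤ B` because `g` and `m` lie in `[0, B]`, and it only lowers the second moment. The
one-sided bound for both signs of the centred function gives the factor 2. -/
theorem bernstein_abs_of_mixing [IsProbabilityMeasure μ] (hF : F.ChainRule)
    (hX : IsStationaryProcess μ X) {k : ℕ} {ρ : ℝ}
    (hρ : mixingCoeff F μ X k ≤ ρ ∨ mixingCoeffRev F μ X k ≤ ρ)
    (g : F.space) {A B V T : ℝ} (hA : F.semi g ≤ A) (hBpos : 0 < B)
    (hB : ∀ x, (g : S → ℝ) x ∈ Icc 0 B)
    (hV : ∫ ω, (g : S → ℝ) (X 1 ω) ^ 2 ∂μ ≤ V)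
    (hT : 0 < T) (hk : 1 ≤ k) {n : ℕ} (hkn : k ≤ n)
    (hη : 2 * n * (Real.exp 1 * (1 + A / B) * ρ) ≤ 1) :
    μ.real {ω | 2 * (T * k * B + Real.sqrt (2 * n * k * V * T))
        ≤ |∑ i ∈ Finset.Icc 1 n, ((g : S → ℝ) (X i ω) - ∫ ω, (g : S → ℝ) (X 1 ω) ∂μ)|}
      ≤ 2 * Real.exp (1 - T) := by
  have hgm := F.measurable_of_mem g g.2
  have hgX : Measurable fun ω => (g : S → ℝ) (X 1 ω) := hgm.comp (hX.measurable 1 le_rfl)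
  set m := ∫ ω, (g : S → ℝ) (X 1 ω) ∂μ with hmdef
  have hgi : Integrable (fun ω => (g : S → ℝ) (X 1 ω)) μ :=
    Integrable.of_bound hgX.aestronglyMeasurable B (Filter.Eventually.of_forall fun ω => by
      rw [Real.norm_of_nonneg (hB _).1]; exact (hB _).2)
  have hgi2 : Integrable (fun ω => (g : S → ℝ) (X 1 ω) ^ 2) μ :=
    Integrable.of_bound (hgX.pow_const 2).aestronglyMeasurable (B ^ 2)
      (Filter.Eventually.of_forall fun ω => by
        rw [norm_pow, Real.norm_of_nonneg (hB _).1]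
        exact pow_le_pow_left₀ (hB _).1 (hB _).2 2)
  have hm0 : 0 ≤ m := integral_nonneg fun ω => (hB _).1
  have hmB : m ≤ B := by
    have := integral_mono hgi (integrable_const B) fun ω => (hB (X 1 ω)).2
    simpa using this
  set c : F.space := ⟨fun _ => m, hF.const_mem m⟩ with hc
  have hc0 : F.semi c = 0 := hF.const c ⟨m, fun _ => rfl⟩
  set G : F.space := g - c with hG
  have hGs : ∀ s, (G : S → ℝ) s = (g : S → ℝ) s - m := fun s => rfl
  have hGA : F.semi G ≤ A := by
    have := map_sub_le_add F.semi g c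
    rw [hc0, add_zero] at this
    exact this.trans hA
  have hGB : ∀ x, |(G : S → ℝ) x| ≤ B := fun x => by
    rw [hGs, abs_le]
    constructor <;> linarith [(hB x).1, (hB x).2]
  have hG0 : ∫ ω, (G : S → ℝ) (X 1 ω) ∂μ = 0 := by
    simp only [hGs]
    rw [integral_sub hgi (integrable_const _)]
    simp [hmdef]
  have hGV : ∫ ω, (G : S → ℝ) (X 1 ω) ^ 2 ∂μ ≤ V := by
    refine le_trans ?_ hV
    have e : ∀ ω, (G : S → ℝ) (X 1 ω) ^ 2
        = (g : S → ℝ) (X 1 ω) ^ 2 - 2 * m * (g : S → ℝ) (X 1 ω) + m ^ 2 := fun ω => by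
      rw [hGs]; ring
    simp only [e]
    have i1 : Integrable (fun ω => (g : S → ℝ) (X 1 ω) ^ 2 - 2 * m * (g : S → ℝ) (X 1 ω)) μ :=
      hgi2.sub (hgi.const_mul _)
    rw [integral_add i1 (integrable_const _),
      integral_sub hgi2 (hgi.const_mul _), integral_const_mul, ← hmdef]
    simp only [integral_const, probReal_univ, smul_eq_mul, one_mul]
    nlinarith [sq_nonneg m]
  have h1 := bernstein_of_mixing hF hX hρ G hGA hBpos hGB hG0 hGV hT hk hkn hη
  have h2 := bernstein_of_mixing hF hX hρ (-G) (A := A) (V := V) (by rwa [map_neg_eq_map]) hBpos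
    (fun x => by simpa using hGB x) (by simpa [integral_neg] using hG0) (by simpa using hGV)
    hT hk hkn hη
  calc _ ≤ μ.real ({ω | 2 * (T * k * B + Real.sqrt (2 * n * k * V * T))
          ≤ ∑ i ∈ Finset.Icc 1 n, (G : S → ℝ) (X i ω)}
        ∪ {ω | 2 * (T * k * B + Real.sqrt (2 * n * k * V * T))
          ≤ ∑ i ∈ Finset.Icc 1 n, ((-G : F.space) : S → ℝ) (X i ω)}) := by
        refine measureReal_mono (fun ω hω => ?_)
        simp only [mem_ofPred_eq, ← hGs] at hω
        rcases le_abs.1 hω with h | h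
        · exact Or.inl h
        · refine Or.inr ?_
          simpa [Finset.sum_neg_distrib] using h
    _ ≤ _ := (measureReal_union_le _ _).trans (by linarith)

end Bernstein

/-! ### Covering balls of an arbitrary norm -/

section Norm

variable {d : ℕ} (N : Seminorm ℝ (Fin d → ℝ))

theorem Seminorm.exists_le_mul_norm_pi : ∃ c : ℝ, 0 < c ∧ ∀ x, N x ≤ c * ‖x‖ := by
  refine ⟨∑ i, N (Pi.single i 1) + 1,
    add_pos_of_nonneg_of_pos (Finset.sum_nonneg fun _ _ => apply_nonneg _ _) one_pos, fun x => ?_⟩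
  have hx : x = ∑ i, x i • (Pi.single i 1 : Fin d → ℝ) := (pi_eq_sum_univ' x)
  calc N x = N (∑ i, x i • (Pi.single i 1 : Fin d → ℝ)) := by rw [← hx]
    _ ≤ ∑ i, N (x i • (Pi.single i 1 : Fin d → ℝ)) :=
        Finset.le_sum_of_subadditive N (map_zero N).le (map_add_le_add N) _ _
    _ ≤ ∑ i, ‖x‖ * N (Pi.single i 1) := by
        refine Finset.sum_le_sum fun i _ => ?_
        rw [map_smul_eq_mul]
        exact mul_le_mul_of_nonneg_right (norm_le_pi_norm x i) (apply_nonneg _ _)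
    _ = (∑ i, N (Pi.single i 1)) * ‖x‖ := by rw [← Finset.mul_sum, mul_comm]
    _ ≤ _ := by
        gcongr
        linarith

theorem Seminorm.continuous_pi : Continuous N := by
  obtain ⟨c, hc, h⟩ := N.exists_le_mul_norm_pi
  refine Seminorm.continuous_of_continuousAt_zero ?_
  rw [ContinuousAt, map_zero]
  refine squeeze_zero (fun x => apply_nonneg _ _) h ?_
  have : Continuous fun x : Fin d → ℝ => c * ‖x‖ := by fun_prop
  simpa using this.tendsto 0

/-- The continuous `N` attains a positive minimum on the compact unit sphere of the maximum norm.
The sphere is empty only in dimension 0, where any constant works. -/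
theorem Seminorm.exists_mul_norm_pi_le (hN : ∀ x, N x = 0 → x = 0) :
    ∃ c : ℝ, 0 < c ∧ ∀ x, c * ‖x‖ ≤ N x := by
  rcases (Metric.sphere (0 : Fin d → ℝ) 1).eq_empty_or_nonempty with he | hne
  · refine ⟨1, one_pos, fun x => ?_⟩
    rcases eq_or_ne x 0 with rfl | hx
    · simp
    · have : ‖x‖⁻¹ • x ∈ Metric.sphere (0 : Fin d → ℝ) 1 := by
        simp [norm_smul, hx]
      simp [he] at this
  · obtain ⟨y, hy, hmin⟩ := (isCompact_sphere (0 : Fin d → ℝ) 1).exists_isMinOn hne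
      N.continuous_pi.continuousOn
    have hy1 : ‖y‖ = 1 := by simpa using hy
    have hy0 : y ≠ 0 := by
      rintro rfl
      simp at hy1
    refine ⟨N y, (apply_nonneg N y).lt_of_ne fun h => hy0 (hN y h.symm), fun x => ?_⟩
    rcases eq_or_ne x 0 with rfl | hx
    · simp
    · have hxs : ‖x‖⁻¹ • x ∈ Metric.sphere (0 : Fin d → ℝ) 1 := by
        simp [norm_smul, hx]
      have h := hmin hxs
      simp only [mem_ofPred_eq, map_smul_eq_mul, norm_inv, norm_norm] at h
      have := norm_pos_iff.2 hx
      rwa [inv_mul_eq_div, le_div_iff₀ this] at h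

/-- Rounding coordinates down to multiples of `u` lands in a grid with at most `2⌈R/u⌉ + 1` values
per coordinate. -/
theorem exists_finset_cover_pi {R u : ℝ} (hR : 0 ≤ R) (hu : 0 < u) :
    ∃ Z : Finset (Fin d → ℝ), (Z.card : ℝ) ≤ (2 * (R / u) + 3) ^ d ∧
      ∀ x, ‖x‖ ≤ R → ∃ z ∈ Z, ‖x - z‖ ≤ u := by
  classical
  set q : ℕ := ⌈R / u⌉₊ with hq
  have hq1 : R / u ≤ q := Nat.le_ceil _
  have hq2 : (q : ℝ) < R / u + 1 := Nat.ceil_lt_add_one (by positivity)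
  refine ⟨(Fintype.piFinset fun _ : Fin d => Finset.Icc (-(q : ℤ)) q).image
    fun m i => u * (m i : ℝ), ?_, fun x hx => ?_⟩
  · calc _ ≤ (((Fintype.piFinset fun _ : Fin d => Finset.Icc (-(q : ℤ)) q).card : ℕ) : ℝ) := by
          exact_mod_cast Finset.card_image_le
      _ = (2 * q + 1 : ℝ) ^ d := by
          have e : ((q : ℤ) + 1 + q).toNat = 2 * q + 1 := by omega
          simp [e]
      _ ≤ _ := by
          gcongr ?_ ^ d
          linarith
  · refine ⟨fun i => u * (⌊x i / u⌋ : ℝ), ?_, ?_⟩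
    · refine Finset.mem_image.2 ⟨fun i => ⌊x i / u⌋, ?_, rfl⟩
      rw [Fintype.mem_piFinset]
      intro i
      have hxi := abs_le.1 (((norm_le_pi_norm x i).trans hx))
      rw [Finset.mem_Icc]
      constructor
      · rw [Int.le_floor]
        push_cast
        rw [le_div_iff₀ hu]
        rw [div_le_iff₀ hu] at hq1
        linarith
      · have : (⌊x i / u⌋ : ℝ) ≤ q := (Int.floor_le _).trans
          ((div_le_div_of_nonneg_right hxi.2 hu.le).trans hq1)
        exact_mod_cast this
    · refine (pi_norm_le_iff_of_nonneg hu.le).2 fun i => ?_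
      have h1 := Int.floor_le (x i / u)
      have h2 := Int.lt_floor_add_one (x i / u)
      rw [le_div_iff₀ hu] at h1
      rw [div_lt_iff₀ hu] at h2
      rw [Pi.sub_apply, Real.norm_eq_abs, abs_le]
      constructor <;> nlinarith

theorem Seminorm.exists_finset_cover (hN : ∀ x, N x = 0 → x = 0) :
    ∃ a : ℝ, 0 < a ∧ ∀ R u : ℝ, 0 ≤ R → 0 < u →
      ∃ Z : Finset (Fin d → ℝ), (Z.card : ℝ) ≤ (a * (R / u) + 3) ^ d ∧
        ∀ x, N x ≤ R → ∃ z ∈ Z, N (x - z) ≤ u := by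
  obtain ⟨c₁, h₁, H₁⟩ := N.exists_mul_norm_pi_le hN
  obtain ⟨c₂, h₂, H₂⟩ := N.exists_le_mul_norm_pi
  refine ⟨2 * c₂ / c₁, by positivity, fun R u hR hu => ?_⟩
  obtain ⟨Z, hZ, hc⟩ := exists_finset_cover_pi (d := d) (R := R / c₁) (u := u / c₂)
    (by positivity) (by positivity)
  refine ⟨Z, hZ.trans (le_of_eq ?_), fun x hx => ?_⟩
  · congr 2
    field_simp
  · obtain ⟨z, hz, hxz⟩ := hc x (by
      rw [le_div_iff₀ h₁, mul_comm]
      exact (H₁ x).trans hx)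
    refine ⟨z, hz, (H₂ _).trans ?_⟩
    rwa [le_div_iff₀ h₂, mul_comm] at hxz

end Norm

/-! ### Decay and second moments of smoothing kernels -/

namespace IsSmoothingKernel

variable {d : ℕ} {N : Seminorm ℝ (Fin d → ℝ)} {K : ℝ → ℝ}

theorem le_zero (hK : IsSmoothingKernel N K) {r : ℝ} (hr : 0 ≤ r) : K r ≤ K 0 :=
  hK.antitone self_mem_Ici hr hr

theorem pos_zero (hK : IsSmoothingKernel N K) : 0 < K 0 := by
  by_contra! h
  refine hK.integral_pos.not_ge (integral_nonpos fun x => ?_)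
  exact (hK.le_zero (apply_nonneg N x)).trans h

/-- By monotonicity `K (N x) ≥ K r` on the maximum-norm ball of radius `r / c₂`, which lies in the
`N`-ball of radius `r`. Hence `K r` times the volume `(2r / c₂)^d` is at most the integral of the
kernel, and `r^d ≥ r` for `r ≥ 1`. -/
theorem exists_le_div (hd : 1 ≤ d) (hK : IsSmoothingKernel N K) :
    ∃ c : ℝ, 0 ≤ c ∧ ∀ r, 1 ≤ r → K r ≤ c / r := by
  obtain ⟨c₂, h₂, H₂⟩ := N.exists_le_mul_norm_pi
  set κ := ∫ x : Fin d → ℝ, K (N x) with hκ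
  have hκ0 : 0 < κ := hK.integral_pos
  refine ⟨κ / (2 / c₂) ^ d, by positivity, fun r hr => ?_⟩
  have hr0 : 0 < r := by linarith
  have hvol : (volume (Metric.closedBall (0 : Fin d → ℝ) (r / c₂))).toReal = (2 * (r / c₂)) ^ d := by
    rw [Real.volume_pi_closedBall _ (by positivity), ENNReal.toReal_ofReal (by positivity)]
    simp
  have h1 : K r * (2 * (r / c₂)) ^ d ≤ κ := by
    calc K r * (2 * (r / c₂)) ^ d
        ≤ ∫ x in Metric.closedBall (0 : Fin d → ℝ) (r / c₂), K (N x) := by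
          rw [← hvol]
          refine setIntegral_ge_of_const_le_real measurableSet_closedBall
            measure_closedBall_lt_top.ne (fun x hx => ?_) hK.integrable.integrableOn
          refine hK.antitone (apply_nonneg N x) hr0.le ((H₂ x).trans ?_)
          rw [mem_closedBall_zero_iff, le_div_iff₀ h₂] at hx
          linarith
      _ ≤ κ := setIntegral_le_integral hK.integrable
          (Filter.Eventually.of_forall fun x => hK.nonneg _ (apply_nonneg N x))
  have h2 : (2 / c₂) ^ d * r ≤ (2 * (r / c₂)) ^ d := by
    have : 2 * (r / c₂) = 2 / c₂ * r := by ring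
    rw [this, mul_pow]
    gcongr
    exact le_self_pow₀ hr (by omega)
  rw [div_div, le_div_iff₀ (by positivity)]
  exact (mul_le_mul_of_nonneg_left h2 (hK.nonneg r hr0.le)).trans h1

theorem mem_Icc (hK : IsSmoothingKernel N K) {h : ℝ} (hh : 0 < h) (x y : Fin d → ℝ) :
    K (N (x - y) / h) ∈ Icc 0 (K 0) :=
  have := div_nonneg (apply_nonneg N (x - y)) hh.le
  ⟨hK.nonneg _ this, hK.le_zero this⟩

theorem continuous_comp (hc : ContinuousOn K (Ici 0)) {h : ℝ} (hh : 0 < h) (x : Fin d → ℝ) :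
    Continuous fun y => K (N (x - y) / h) := by
  have hN := N.continuous_pi
  exact hc.comp_continuous (by fun_prop) fun y => div_nonneg (apply_nonneg N _) hh.le

theorem comp_eq {h : ℝ} (hh : 0 < h) (x y : Fin d → ℝ) :
    K (N (x - y) / h) = (fun z => K (N (h⁻¹ • z))) (x - y) := by
  simp only [map_smul_eq_mul]
  rw [Real.norm_of_nonneg (inv_nonneg.2 hh.le), inv_mul_eq_div]

theorem integrable_comp (hK : IsSmoothingKernel N K) {h : ℝ} (hh : 0 < h) (x : Fin d → ℝ) :
    Integrable fun y => K (N (x - y) / h) := by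
  simp only [comp_eq hh]
  exact (hK.integrable.comp_smul (inv_ne_zero hh.ne')).comp_sub_left x

theorem integral_comp {h : ℝ} (hh : 0 < h) (x : Fin d → ℝ) :
    ∫ y, K (N (x - y) / h) = h ^ d * ∫ y : Fin d → ℝ, K (N y) := by
  simp only [comp_eq hh]
  rw [integral_sub_left_eq_self (fun z => K (N (h⁻¹ • z))) volume x,
    Measure.integral_comp_inv_smul_of_nonneg volume (fun z => K (N z)) hh.le]
  simp

/-- One factor `K` is bounded by `K 0`; the other is integrated against Lebesgue measure after
bounding the density, and scaling yields `h^d`. This is the source of `‖f‖_∞` under the square root.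
-/
theorem integral_sq_le (hK : IsSmoothingKernel N K) {f : (Fin d → ℝ) → ℝ}
    (hf0 : ∀ x, 0 ≤ f x) (hf : eLpNorm f ∞ volume < ∞) {h : ℝ}
    (hh : 0 < h) (x : Fin d → ℝ) :
    ∫ y, K (N (x - y) / h) ^ 2 ∂(volume.withDensity fun x => ENNReal.ofReal (f x))
      ≤ K 0 * (∫ y : Fin d → ℝ, K (N y)) * lInftyNorm f * h ^ d := by
  set c := eLpNorm f ∞ volume with hcdef
  have hle : volume.withDensity (fun x => ENNReal.ofReal (f x)) ≤ c • volume := by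
    rw [← withDensity_const]
    refine withDensity_mono ?_
    filter_upwards [ae_le_eLpNormEssSup (f := f) (μ := volume)] with y hy
    rw [hcdef, eLpNorm_exponent_top]
    rwa [Real.enorm_eq_ofReal (hf0 y)] at hy
  have hint := hK.integrable_comp hh x
  have hint2 : Integrable fun y => K (N (x - y) / h) ^ 2 := by
    have : Integrable fun y => K (N (x - y) / h) * K (N (x - y) / h) := by
      refine hint.mul_bdd (c := K 0) hint.aestronglyMeasurable
        (Filter.Eventually.of_forall fun y => ?_)
      rw [Real.norm_of_nonneg (hK.mem_Icc hh x y).1]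
      exact (hK.mem_Icc hh x y).2
    simpa only [sq] using this
  calc _ ≤ ∫ y, K (N (x - y) / h) ^ 2 ∂(c • volume) :=
        integral_mono_measure hle (Filter.Eventually.of_forall fun y => sq_nonneg _)
          (hint2.smul_measure hf.ne)
    _ = lInftyNorm f * ∫ y, K (N (x - y) / h) ^ 2 := by
        rw [integral_smul_measure]
        rfl
    _ ≤ lInftyNorm f * ∫ y, K 0 * K (N (x - y) / h) := by
        refine mul_le_mul_of_nonneg_left (integral_mono hint2 (hint.const_mul _) fun y => ?_)
          ENNReal.toReal_nonneg
        simp only [sq]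
        exact mul_le_mul_of_nonneg_right (hK.mem_Icc hh x y).2 (hK.mem_Icc hh x y).1
    _ = _ := by
        rw [integral_const_mul, integral_comp hh]
        ring

end IsSmoothingKernel

/-! ### From a finite net to all of `ℝ^d` -/

section Smoothing

variable {d : ℕ} {N : Seminorm ℝ (Fin d → ℝ)} {K : ℝ → ℝ}

theorem kSmoothing_empiricalMeasure (h : ℝ) (p : ℕ → Fin d → ℝ) (n : ℕ) (x : Fin d → ℝ) :
    kSmoothing N K h (empiricalMeasure p n) x
      = (h ^ d)⁻¹ * ((n : ℝ)⁻¹ * ∑ i ∈ Finset.Icc 1 n, K (N (x - p i) / h)) := by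
  rw [kSmoothing, empiricalMeasure, integral_smul_measure, integral_finsetSum_measure]
  · simp
  · intro i _
    exact integrable_dirac (by simp)

theorem abs_sum_sub_integral_le {P : Measure (Fin d → ℝ)} [IsProbabilityMeasure P]
    {g₁ g₂ : (Fin d → ℝ) → ℝ} (h₁ : Integrable g₁ P) (h₂ : Integrable g₂ P) {e : ℝ}
    (he : ∀ y, |g₁ y - g₂ y| ≤ e) (p : ℕ → Fin d → ℝ) (n : ℕ) :
    |∑ i ∈ Finset.Icc 1 n, (g₁ (p i) - ∫ y, g₁ y ∂P)|
      ≤ |∑ i ∈ Finset.Icc 1 n, (g₂ (p i) - ∫ y, g₂ y ∂P)| + n * (2 * e) := by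
  have hi : |∫ y, g₁ y ∂P - ∫ y, g₂ y ∂P| ≤ e := by
    rw [← integral_sub h₁ h₂]
    simpa using norm_integral_le_of_norm_le_const (μ := P) (f := fun y => g₁ y - g₂ y)
      (Filter.Eventually.of_forall he)
  have hd : |∑ i ∈ Finset.Icc 1 n, ((g₁ (p i) - ∫ y, g₁ y ∂P) - (g₂ (p i) - ∫ y, g₂ y ∂P))|
      ≤ n * (2 * e) := by
    refine (Finset.abs_sum_le_sum_abs _ _).trans ?_
    have : ∑ i ∈ Finset.Icc 1 n, |(g₁ (p i) - ∫ y, g₁ y ∂P) - (g₂ (p i) - ∫ y, g₂ y ∂P)|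
        ≤ ∑ i ∈ Finset.Icc 1 n, 2 * e := by
      refine Finset.sum_le_sum fun i _ => ?_
      have h3 := abs_le.1 (he (p i))
      have h4 := abs_le.1 hi
      rw [abs_le]
      constructor <;> linarith [h3.1, h3.2, h4.1, h4.2]
    simpa using this
  rw [Finset.sum_sub_distrib] at hd
  have := abs_sub_abs_le_abs_sub (∑ i ∈ Finset.Icc 1 n, (g₁ (p i) - ∫ y, g₁ y ∂P))
    (∑ i ∈ Finset.Icc 1 n, (g₂ (p i) - ∫ y, g₂ y ∂P))
  linarith

/-- Passage from finitely many centres to the supremum over all of `ℝ^d`. -/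
theorem supNorm_kSmoothing_sub_le (hK : IsSmoothingKernel N K) {L β : ℝ≥0}
    (hKβ : HolderOnWith L β K (Ici 0)) (hβ : 0 < β) {c : ℝ} (hc : 0 ≤ c)
    (hKc : ∀ r, 1 ≤ r → K r ≤ c / r) {P : Measure (Fin d → ℝ)} [IsProbabilityMeasure P]
    {r₀ h : ℝ} (hP : P {x | r₀ < N x} = 0) (hh : 0 < h) {n : ℕ} (hn : 1 ≤ n)
    {p : ℕ → Fin d → ℝ} (hp : ∀ i ∈ Finset.Icc 1 n, N (p i) ≤ r₀) {u : ℝ}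
    (hu : (u / h) ^ (β : ℝ) ≤ 1 / n) {Z : Finset (Fin d → ℝ)}
    (hZ : ∀ x, N x ≤ r₀ + h * n → ∃ z ∈ Z, N (x - z) ≤ u) {ε : ℝ} (hε : 0 ≤ ε)
    (hdev : ∀ z ∈ Z, |∑ i ∈ Finset.Icc 1 n,
      (K (N (z - p i) / h) - ∫ y, K (N (z - y) / h) ∂P)| ≤ ε) :
    supNorm (fun x => kSmoothing N K h (empiricalMeasure p n) x - kSmoothing N K h P x)
      ≤ (h ^ d)⁻¹ * ((ε + (2 * L + c)) / n) := by
  have hn0 : (0 : ℝ) < n := by exact_mod_cast hn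
  have hL : (0 : ℝ) ≤ L := L.2
  have hint : ∀ x, Integrable (fun y => K (N (x - y) / h)) P := fun x =>
    Integrable.of_bound (IsSmoothingKernel.continuous_comp
      (hKβ.continuousOn hβ) hh x).aestronglyMeasurable (K 0)
      (Filter.Eventually.of_forall fun y => by
        rw [Real.norm_of_nonneg (hK.mem_Icc hh x y).1]
        exact (hK.mem_Icc hh x y).2)
  have key : ∀ x, |∑ i ∈ Finset.Icc 1 n, (K (N (x - p i) / h) - ∫ y, K (N (x - y) / h) ∂P)|
      ≤ ε + (2 * L + c) := fun x => by
    -- Near points: moving to the net changes each kernel value by at most `L / n`, for `2L` in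
    -- total. Far points: the ball `B_{r₀}` is at scaled distance at least `n`, so each term is at
    -- most `c / n`, for `c` in total.
    rcases le_or_gt (N x) (r₀ + h * n) with hx | hx
    · obtain ⟨z, hz, hxz⟩ := hZ x hx
      have hdist : ∀ y, |K (N (x - y) / h) - K (N (z - y) / h)| ≤ L * (1 / n) := fun y => by
        have h1 : dist (N (x - y) / h) (N (z - y) / h) ≤ u / h := by
          rw [Real.dist_eq, ← sub_div, abs_div, abs_of_pos hh]
          refine div_le_div_of_nonneg_right ?_ hh.le
          have := abs_sub_map_le_sub N (x - y) (z - y)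
          rw [sub_sub_sub_cancel_right] at this
          exact this.trans hxz
        have h2 := hKβ.dist_le_of_le (div_nonneg (apply_nonneg N (x - y)) hh.le)
          (div_nonneg (apply_nonneg N (z - y)) hh.le) h1
        exact h2.trans (mul_le_mul_of_nonneg_left hu hL)
      refine (abs_sum_sub_integral_le (hint x) (hint z) hdist p n).trans ?_
      have : (n : ℝ) * (2 * (L * (1 / n))) = 2 * L := by field_simp
      rw [this]
      linarith [hdev z hz]
    · have hsmall : ∀ y, N y ≤ r₀ → K (N (x - y) / h) ∈ Icc 0 (c / n) := fun y hy => by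
        refine ⟨(hK.mem_Icc hh x y).1, ?_⟩
        have h1 : (n : ℝ) ≤ N (x - y) / h := by
          rw [le_div_iff₀ hh]
          have := map_sub_le_add N x y
          have h2 : N x ≤ N (x - y) + N y := by
            simpa using map_add_le_add N (x - y) y
          linarith
        exact (hK.antitone hn0.le (hn0.le.trans h1) h1).trans (hKc n (by exact_mod_cast hn))
      have hi0 : 0 ≤ ∫ y, K (N (x - y) / h) ∂P := integral_nonneg fun y => (hK.mem_Icc hh x y).1
      have hi1 : ∫ y, K (N (x - y) / h) ∂P ≤ c / n := by
        have hae : ∀ᵐ y ∂P, K (N (x - y) / h) ≤ c / n := by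
          have : ∀ᵐ y ∂P, ¬ (r₀ < N y) := measure_eq_zero_iff_ae_notMem.1 hP
          filter_upwards [this] with y hy
          exact (hsmall y (not_lt.1 hy)).2
        simpa using integral_mono_ae (hint x) (integrable_const _) hae
      calc _ ≤ ∑ i ∈ Finset.Icc 1 n, |K (N (x - p i) / h) - ∫ y, K (N (x - y) / h) ∂P| :=
            Finset.abs_sum_le_sum_abs _ _
        _ ≤ ∑ i ∈ Finset.Icc 1 n, c / n := by
            refine Finset.sum_le_sum fun i hi => ?_
            have := hsmall (p i) (hp i hi)
            rw [abs_le]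
            constructor <;> linarith [this.1, this.2]
        _ = c := by
            rw [Finset.sum_const, Nat.card_Icc, nsmul_eq_mul, Nat.add_sub_cancel]
            field_simp
        _ ≤ _ := by linarith
  refine supNorm_le (by positivity) fun x => ?_
  have e : kSmoothing N K h (empiricalMeasure p n) x - kSmoothing N K h P x
      = (h ^ d)⁻¹ * ((∑ i ∈ Finset.Icc 1 n,
        (K (N (x - p i) / h) - ∫ y, K (N (x - y) / h) ∂P)) / n) := by
    rw [kSmoothing_empiricalMeasure, kSmoothing, Finset.sum_sub_distrib]
    simp only [Finset.sum_const, Nat.card_Icc, nsmul_eq_mul, Nat.add_sub_cancel]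
    field_simp
  rw [e, abs_mul, abs_div, abs_of_pos hn0, abs_of_pos (by positivity : 0 < (h ^ d)⁻¹)]
  gcongr
  exact key x

theorem supNorm_kSmoothing_sub_le_trivial (hK : IsSmoothingKernel N K)
    {P : Measure (Fin d → ℝ)} [IsProbabilityMeasure P]
    {h : ℝ} (hh : 0 < h) (n : ℕ) (p : ℕ → Fin d → ℝ)
    (hc : ContinuousOn K (Ici 0)) :
    supNorm (fun x => kSmoothing N K h (empiricalMeasure p n) x - kSmoothing N K h P x)
      ≤ (h ^ d)⁻¹ * K 0 := by
  have hK0 := hK.pos_zero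
  refine supNorm_le (by positivity) fun x => ?_
  rw [kSmoothing_empiricalMeasure, kSmoothing, ← mul_sub, abs_mul,
    abs_of_pos (by positivity : 0 < (h ^ d)⁻¹)]
  refine mul_le_mul_of_nonneg_left ?_ (by positivity)
  have hi0 : 0 ≤ ∫ y, K (N (x - y) / h) ∂P := integral_nonneg fun y => (hK.mem_Icc hh x y).1
  have hi1 : ∫ y, K (N (x - y) / h) ∂P ≤ K 0 := by
    have := integral_mono (μ := P) (Integrable.of_bound (IsSmoothingKernel.continuous_comp
      hc hh x).aestronglyMeasurable (K 0) (Filter.Eventually.of_forall fun y => by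
        rw [Real.norm_of_nonneg (hK.mem_Icc hh x y).1]
        exact (hK.mem_Icc hh x y).2)) (integrable_const (K 0)) fun y => (hK.mem_Icc hh x y).2
    simpa using this
  have hs0 : 0 ≤ ∑ i ∈ Finset.Icc 1 n, K (N (x - p i) / h) :=
    Finset.sum_nonneg fun i _ => (hK.mem_Icc hh x _).1
  have hs1 : ∑ i ∈ Finset.Icc 1 n, K (N (x - p i) / h) ≤ n * K 0 := by
    have := Finset.sum_le_sum fun i (_ : i ∈ Finset.Icc 1 n) => (hK.mem_Icc hh x (p i)).2
    simpa using this
  have hs2 : (n : ℝ)⁻¹ * ∑ i ∈ Finset.Icc 1 n, K (N (x - p i) / h) ≤ K 0 := by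
    rcases Nat.eq_zero_or_pos n with rfl | hn
    · simpa using hK0.le
    · rwa [inv_mul_le_iff₀ (by positivity)]
  have hs3 : 0 ≤ (n : ℝ)⁻¹ * ∑ i ∈ Finset.Icc 1 n, K (N (x - p i) / h) := by positivity
  rw [abs_le]
  constructor <;> linarith

end Smoothing

/-! ### The threshold on `n` and the constants -/

section Threshold

theorem one_le_log_of_three_le {x : ℝ} (hx : 3 ≤ x) : 1 ≤ Real.log x := by
  rw [Real.le_log_iff_exp_le (by linarith)]
  linarith [Real.exp_one_lt_d9]

theorem exists_nat_four_le_div_log_rpow (x p : ℝ) :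
    ∃ m : ℕ, 3 ≤ m ∧ x ≤ (m : ℝ) ∧ 4 ≤ (m : ℝ) / Real.log m ^ p := by
  have h1 := (isLittleO_log_rpow_rpow_atTop p one_pos).bound (by norm_num : (0 : ℝ) < 1 / 4)
  have h2 := (tendsto_natCast_atTop_atTop (R := ℝ)).eventually
    (h1.and (Filter.eventually_ge_atTop x))
  obtain ⟨m, ⟨hm1, hm2⟩, hm3⟩ := (h2.and (Filter.eventually_ge_atTop 3)).exists
  have hm : (3 : ℝ) ≤ m := by exact_mod_cast hm3
  have hl : 0 < Real.log m ^ p :=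
    Real.rpow_pos_of_pos (one_pos.trans_le (one_le_log_of_three_le hm)) p
  refine ⟨m, hm3, hm2, ?_⟩
  rw [le_div_iff₀ hl]
  rw [Real.rpow_one, Real.norm_of_nonneg hl.le, Real.norm_of_nonneg (by positivity)] at hm1
  linarith

theorem of_nZeroStar_le {d : ℕ} {c₀ b γ h φh K0 : ℝ} {n : ℕ}
    (hn : nZeroStar d c₀ b γ h φh K0 ≤ n) :
    3 ≤ n ∧ (808 * c₀ * (3 * (h ^ d)⁻¹ * φh + K0) / (2 * K0)) ^ (1 / ((d : ℝ) + 1)) ≤ (n : ℝ) ∧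
      ((d : ℝ) + 1) / b ≤ Real.log n := by
  obtain ⟨h1, h2⟩ := max_le_iff.1 hn
  -- Nonemptiness is essential: `sInf ∅ = 0` would carry no information. The lower bounds on the
  -- least `m` pass to every larger `n`.
  have hmem := Nat.sInf_mem (s := {m : ℕ | 3 ≤ m ∧
        (808 * c₀ * (3 * (h ^ d)⁻¹ * φh + K0) / (2 * K0)) ^ (1 / ((d : ℝ) + 1)) ≤ (m : ℝ) ∧
        4 ≤ (m : ℝ) / Real.log m ^ (2 / γ)}) (exists_nat_four_le_div_log_rpow _ _)
  have h3 : 3 ≤ n := hmem.1.trans (by exact_mod_cast h1)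
  refine ⟨h3, hmem.2.1.trans h1, ?_⟩
  rwa [Real.le_log_iff_exp_le (by positivity)]

/-- Since `κ^γ ≥ 2 (log n)²` and `b log n ≥ d + 1`, the mixing rate is at most `c₀ n^{-2(d+1)}`. One
factor `n^{d+1}` absorbs the leading `n`, the other absorbs `c₀ (1 + φh / K0)`. -/
theorem mixing_remainder_le {d : ℕ} {c₀ b γ h φh K0 κ : ℝ} {n : ℕ} (hc₀ : 0 < c₀) (hb : 0 < b)
    (hγ : 0 < γ) (hh : 0 < h) (hh1 : h ≤ 1) (hφ : 0 < φh) (hK0 : 0 < K0)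
    (hn : nZeroStar d c₀ b γ h φh K0 ≤ n)
    (hκ : 2 ^ (1 / γ) * Real.log n ^ (2 / γ) ≤ κ) :
    2 * n * (Real.exp 1 * (1 + φh / K0) * (c₀ * Real.exp (-b * κ ^ γ))) ≤ 1 := by
  obtain ⟨hn3, hX, hlb⟩ := of_nZeroStar_le hn
  have hn3' : (3 : ℝ) ≤ n := by exact_mod_cast hn3
  have hn0 : (0 : ℝ) < n := by linarith
  set l := Real.log n with hl
  have hl1 : 1 ≤ l := one_le_log_of_three_le hn3'
  have hκγ : 2 * l ^ 2 ≤ κ ^ γ := by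
    have := Real.rpow_le_rpow (by positivity) hκ hγ.le
    rwa [Real.mul_rpow (by positivity) (by positivity), ← Real.rpow_mul (by norm_num),
      ← Real.rpow_mul (by positivity), one_div_mul_cancel hγ.ne', div_mul_cancel₀ _ hγ.ne',
      Real.rpow_one, Real.rpow_two] at this
  set M : ℝ := (n : ℝ) ^ (d + 1) with hM
  have hM0 : 0 < M := by positivity
  have hnM : (n : ℝ) ≤ M := le_self_pow₀ (by linarith) (by omega)
  have hexp : Real.exp (-b * κ ^ γ) ≤ (M ^ 2)⁻¹ := by
    have h1 : ((d : ℝ) + 1) * l * 2 ≤ b * κ ^ γ := by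
      rw [div_le_iff₀ hb] at hlb
      calc ((d : ℝ) + 1) * l * 2 ≤ (l * b) * l * 2 := by gcongr
        _ = b * (2 * l ^ 2) := by ring
        _ ≤ _ := by gcongr
    have h2 : M ^ 2 = Real.exp (((d : ℝ) + 1) * l * 2) := by
      rw [hM, ← Real.exp_log hn0, ← hl, ← Real.exp_nat_mul, ← Real.exp_nat_mul]
      push_cast
      ring_nf
    rw [h2, ← Real.exp_neg]
    exact Real.exp_le_exp.2 (by linarith)
  have hcM : c₀ * (1 + φh / K0) ≤ M / 404 := by
    set Y := 808 * c₀ * (3 * (h ^ d)⁻¹ * φh + K0) / (2 * K0) with hY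
    have hY0 : 0 ≤ Y := by positivity
    have h1 : Y ≤ M := by
      have := pow_le_pow_left₀ (by positivity) hX (d + 1)
      rwa [← Real.rpow_natCast, ← Real.rpow_mul hY0, Nat.cast_add, Nat.cast_one,
        one_div_mul_cancel (by positivity), Real.rpow_one] at this
    have h2 : 1 ≤ (h ^ d)⁻¹ := (one_le_inv₀ (by positivity)).2 (pow_le_one₀ hh.le hh1)
    have h3 : 404 * (c₀ * (1 + φh / K0)) ≤ Y := by
      have : 404 * (c₀ * (1 + φh / K0)) = 808 * c₀ * (φh + K0) / (2 * K0) := by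
        field_simp
        ring
      rw [this, hY]
      gcongr
      nlinarith
    linarith
  have he : Real.exp 1 ≤ 3 := by linarith [Real.exp_one_lt_d9]
  calc _ = 2 * n * (Real.exp 1 * (c₀ * (1 + φh / K0)) * Real.exp (-b * κ ^ γ)) := by ring
    _ ≤ 2 * M * (3 * (M / 404) * (M ^ 2)⁻¹) := by gcongr
    _ = 6 / 404 := by
      field_simp
      norm_num
    _ ≤ 1 := by norm_num

/-- With `W = n r₀ / h`, both `n` and `r₀ / h` are at most `W`, so the net has polynomial size in
`W`. -/
theorem cover_card_bound {d : ℕ} {a β r₀ h n card : ℝ} (ha : 0 < a) (hβ : 0 < β)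
    (hr₀ : 1 ≤ r₀) (hh : 0 < h) (hh1 : h ≤ 1) (hn : 3 ≤ n)
    (hcard : card ≤ (a * ((r₀ + h * n) / (h * n ^ (-(1 / β)))) + 3) ^ d) :
    card ≤ ((2 * a + 3) * (n * r₀ / h) ^ (1 + 1 / β)) ^ d := by
  have hn0 : 0 < n := by linarith
  have hnW : n ≤ n * r₀ / h := by
    rw [le_div_iff₀ hh]
    nlinarith
  have hrW : r₀ / h ≤ n * r₀ / h := by
    gcongr
    nlinarith
  set W := n * r₀ / h with hW
  have hW1 : 1 ≤ W := by linarith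
  refine hcard.trans ?_
  gcongr ?_ ^ d
  have h1 : (r₀ + h * n) / (h * n ^ (-(1 / β))) ≤ 2 * W ^ (1 + 1 / β) := by
    have e : (r₀ + h * n) / (h * n ^ (-(1 / β))) = (r₀ / h + n) * n ^ (1 / β) := by
      rw [Real.rpow_neg hn0.le]
      field_simp
    rw [e, Real.rpow_add (by linarith), Real.rpow_one, ← mul_assoc]
    gcongr
    linarith
  have h2 : 1 ≤ W ^ (1 + 1 / β) := Real.one_le_rpow hW1 (by positivity)
  nlinarith

theorem sqrt_variance_eq {n k K0 κ f D T : ℝ} (hn : 0 < n) (hD : 0 < D) :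
    Real.sqrt (2 * n * k * (K0 * κ * f * D) * T) / (D * n)
      = Real.sqrt (2 * k * K0 * κ * f * T / (D * n)) := by
  have h0 : 0 < D * n := by positivity
  rw [eq_comm, ← Real.sqrt_sq h0.le, ← Real.sqrt_div' _ (sq_nonneg _), Real.sqrt_sq h0.le]
  congr 1
  field_simp

/-- The range term and the discretisation error `C₂` go into the second summand, using `E, l ≥ 1`
for the latter; the variance term goes into the square root. The extra `C₃` in the constant serves
`trivial_bound_le`. -/
theorem deviation_bound_le {n k K0 κ f D T C₁ C₂ C₃ E l : ℝ} (hn : 0 < n) (hD : 0 < D)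
    (hK0 : 0 < K0) (hκ : 0 < κ) (hf : 0 ≤ f) (hC₁ : 0 ≤ C₁) (hC₂ : 0 ≤ C₂) (hC₃ : 0 ≤ C₃)
    (hE : 1 ≤ E) (hl : 1 ≤ l) (hT0 : 0 ≤ T) (hT : T ≤ C₁ * E) (hk0 : 0 ≤ k) (hk : k ≤ C₃ * l) :
    D⁻¹ * ((2 * (T * k * K0 + Real.sqrt (2 * n * k * (K0 * κ * f * D) * T)) + C₂) / n)
      ≤ (2 * C₁ * C₃ + C₂ / K0 + 2 * Real.sqrt (2 * C₁ * C₃ * K0 * κ) + C₃)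
        * (Real.sqrt (f * E * l / (D * n)) + K0 * E * l / (D * n)) := by
  have hE0 : 0 ≤ E := by linarith
  have hl0 : 0 ≤ l := by linarith
  set s := Real.sqrt (f * E * l / (D * n)) with hs
  set c := Real.sqrt (2 * C₁ * C₃ * K0 * κ) with hc
  have hs0 : 0 ≤ s := Real.sqrt_nonneg _
  have hc0 : 0 ≤ c := Real.sqrt_nonneg _
  set A := K0 * E * l / (D * n) with hA
  have hA0 : 0 ≤ A := by positivity
  have e : D⁻¹ * ((2 * (T * k * K0 + Real.sqrt (2 * n * k * (K0 * κ * f * D) * T)) + C₂) / n)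
      = 2 * (T * k * K0 / (D * n))
        + 2 * (Real.sqrt (2 * n * k * (K0 * κ * f * D) * T) / (D * n)) + C₂ / (D * n) := by
    field_simp
  rw [e, sqrt_variance_eq hn hD]
  have h1 : T * k * K0 / (D * n) ≤ C₁ * C₃ * A := by
    calc T * k * K0 / (D * n) ≤ (C₁ * E) * (C₃ * l) * K0 / (D * n) := by gcongr
      _ = _ := by rw [hA]; ring
  have h2 : Real.sqrt (2 * k * K0 * κ * f * T / (D * n)) ≤ c * s := by
    rw [hc, hs, ← Real.sqrt_mul (by positivity)]
    refine Real.sqrt_le_sqrt ?_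
    calc 2 * k * K0 * κ * f * T / (D * n)
        ≤ 2 * (C₃ * l) * K0 * κ * f * (C₁ * E) / (D * n) := by gcongr
      _ = _ := by ring
  have h3 : C₂ / (D * n) ≤ C₂ / K0 * A := by
    have : C₂ / K0 * A = C₂ * (E * l) / (D * n) := by
      rw [hA]; field_simp
    rw [this]
    gcongr
    exact le_mul_of_one_le_right hC₂ (one_le_mul_of_one_le_of_one_le hE hl)
  have h4 : 0 ≤ (2 * C₁ * C₃ + C₂ / K0 + C₃) * s := by positivity
  have h5 : 0 ≤ 2 * c * A + C₃ * A := by positivity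
  linarith

theorem trivial_bound_le {n K0 D C₁ C₃ c E l x : ℝ} (hn : 0 < n) (hD : 0 < D) (hK0 : 0 < K0)
    (hC₁ : 0 ≤ C₁) (hC₃ : 0 ≤ C₃) (hc : C₁ + C₃ ≤ c) (hE : 1 ≤ E) (hl : 1 ≤ l) (hx : 0 ≤ x)
    (hnk : n ≤ C₃ * l) :
    D⁻¹ * K0 ≤ c * (x + K0 * E * l / (D * n)) := by
  have hE0 : 0 ≤ E := by linarith
  have hl0 : 0 ≤ l := by linarith
  have hc0 : 0 ≤ c := by linarith
  calc D⁻¹ * K0 = K0 * 1 * n / (D * n) := by field_simp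
    _ ≤ K0 * E * (C₃ * l) / (D * n) := by gcongr
    _ = C₃ * (K0 * E * l / (D * n)) := by ring
    _ ≤ c * (K0 * E * l / (D * n)) := by
        gcongr
        linarith
    _ ≤ _ := by
        gcongr
        linarith

end Threshold

/-! ### Union bound and conclusion -/

/-- Subadditivity suffices, so the event `A`, which involves an uncountable supremum, need not be
shown measurable. -/
theorem one_sub_le_measureReal_of_compl {Ω : Type*} [MeasurableSpace Ω] {μ : Measure Ω}
    [IsProbabilityMeasure μ] {A B : Set Ω} {p : ℝ} (hAB : Bᶜ ⊆ A) (hB : μ.real B ≤ p) :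
    1 - p ≤ μ.real A := by
  have h := measureReal_union_le (μ := μ) A B
  have hu : A ∪ B = univ := eq_univ_of_forall fun ω => by
    by_cases hω : ω ∈ B
    · exact Or.inr hω
    · exact Or.inl (hAB hω)
  rw [hu, probReal_univ] at h
  linarith

theorem mixingCoeff_le_or_rev_le {Ω S : Type*} [MeasurableSpace Ω] [MeasurableSpace S]
    {F : FunctionClass S} {μ : Measure Ω} {X : ℕ → Ω → S} {c₀ b γ : ℝ}
    (h : IsGeomMixing F μ X c₀ b γ ∨ IsGeomMixingRev F μ X c₀ b γ) {k : ℕ} (hk : 1 ≤ k) :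
    mixingCoeff F μ X k ≤ c₀ * Real.exp (-b * (k : ℝ) ^ γ) ∨
      mixingCoeffRev F μ X k ≤ c₀ * Real.exp (-b * (k : ℝ) ^ γ) :=
  h.imp (fun h => h k hk) fun h => h k hk

theorem measureReal_kernel_deviation_le {d : ℕ} {N : Seminorm ℝ (Fin d → ℝ)} {K : ℝ → ℝ}
    (hK : IsSmoothingKernel N K) (hKc : ContinuousOn K (Ici 0))
    {Ω : Type*} [MeasurableSpace Ω] {μ : Measure Ω} [IsProbabilityMeasure μ]
    {S : Set (Fin d → ℝ)} {F : FunctionClass S} (hF : F.ChainRule)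
    {φ : ℝ → ℝ} (hφ : KernelInClass N K F φ)
    {X : ℕ → Ω → S} (hX : IsStationaryProcess μ X) {k : ℕ} {ρ : ℝ}
    (hρ : mixingCoeff F μ X k ≤ ρ ∨ mixingCoeffRev F μ X k ≤ ρ)
    {f : (Fin d → ℝ) → ℝ} (hf0 : ∀ x, 0 ≤ f x)
    (hP : μ.map (fun ω => (X 1 ω : Fin d → ℝ)) = volume.withDensity fun x => ENNReal.ofReal (f x))
    (hf : eLpNorm f ∞ volume < ∞) {h T : ℝ} (hh : 0 < h)
    (hT : 0 < T) (hk : 1 ≤ k) {n : ℕ} (hkn : k ≤ n)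
    (hη : 2 * n * (Real.exp 1 * (1 + φ h / K 0) * ρ) ≤ 1) (z : Fin d → ℝ) :
    μ.real {ω | 2 * (T * k * K 0 + Real.sqrt (2 * n * k *
          (K 0 * (∫ y : Fin d → ℝ, K (N y)) * lInftyNorm f * h ^ d) * T))
        ≤ |∑ i ∈ Finset.Icc 1 n, (K (N (z - X i ω) / h)
          - ∫ y, K (N (z - y) / h) ∂(μ.map fun ω => (X 1 ω : Fin d → ℝ)))|}
      ≤ 2 * Real.exp (1 - T) := by
  have hXm : Measurable fun ω => (X 1 ω : Fin d → ℝ) :=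
    measurable_subtype_coe.comp (hX.measurable 1 le_rfl)
  obtain ⟨-, hz⟩ := hφ h hh
  obtain ⟨hmem, hsemi⟩ := hz z
  have hcont := IsSmoothingKernel.continuous_comp (N := N) hKc hh z
  have hm := integral_map hXm.aemeasurable (hcont.aestronglyMeasurable
    (μ := μ.map fun ω => (X 1 ω : Fin d → ℝ)))
  have hm2 := integral_map hXm.aemeasurable ((hcont.pow 2).aestronglyMeasurable
    (μ := μ.map fun ω => (X 1 ω : Fin d → ℝ)))
  rw [hm]
  refine bernstein_abs_of_mixing hF hX hρ ⟨_, hmem⟩ hsemi hK.pos_zero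
    (fun y => hK.mem_Icc hh z y) ?_ hT hk hkn hη
  refine hm2.symm.le.trans ?_
  rw [hP]
  exact hK.integral_sq_le hf0 hf hh z

theorem measure_exists_norm_gt_eq_zero {d : ℕ} {N : Seminorm ℝ (Fin d → ℝ)}
    {Ω : Type*} [MeasurableSpace Ω] {μ : Measure Ω} {S : Set (Fin d → ℝ)}
    {X : ℕ → Ω → S} (hX : IsStationaryProcess μ X) {r₀ : ℝ}
    (hP : μ.map (fun ω => (X 1 ω : Fin d → ℝ)) {x | r₀ < N x} = 0) {i : ℕ} (hi : 1 ≤ i) :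
    μ {ω | r₀ < N (X i ω)} = 0 := by
  have hN := N.continuous_pi
  have hmeas : MeasurableSet {x : S | r₀ < N x} :=
    measurableSet_lt measurable_const (hN.measurable.comp measurable_subtype_coe)
  have hmeas' : MeasurableSet {x : Fin d → ℝ | r₀ < N x} :=
    measurableSet_lt measurable_const hN.measurable
  have h1 : μ.map (X i) {x : S | r₀ < N x} = μ {ω | r₀ < N (X i ω)} :=
    Measure.map_apply (hX.measurable i hi) hmeas
  have h2 : μ.map (X 1) {x : S | r₀ < N x} = μ {ω | r₀ < N (X 1 ω)} :=
    Measure.map_apply (hX.measurable 1 le_rfl) hmeas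
  have hXm : Measurable fun ω => (X 1 ω : Fin d → ℝ) :=
    measurable_subtype_coe.comp (hX.measurable 1 le_rfl)
  rw [Measure.map_apply hXm hmeas'] at hP
  rw [← h1, hX.map_eq hi, h2]
  exact hP

theorem mainTheorem5 {d : ℕ} (hd : 1 ≤ d)
    -- an arbitrary norm on `ℝ^d`
    (N : Seminorm ℝ (Fin d → ℝ)) (hN : ∀ x, N x = 0 → x = 0)
    -- a `β`-Hölder continuous smoothing kernel
    (K : ℝ → ℝ) (hK : IsSmoothingKernel N K)
    (β : ℝ≥0) (hβ0 : 0 < β) (hβ1 : β ≤ 1)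
    (hKβ : ∃ L : ℝ≥0, HolderOnWith L β K (Set.Ici 0))
    (γ : ℝ) (hγ : 0 < γ) :
    ∃ C : ℝ, 0 < C ∧
      ∀ {Ω : Type*} [MeasurableSpace Ω] (μ : Measure Ω) [IsProbabilityMeasure μ]
        (S : Set (Fin d → ℝ)) (F : FunctionClass S) (_ : F.ChainRule)
        (φ : ℝ → ℝ) (_ : KernelInClass N K F φ)
        (X : ℕ → Ω → S) (_ : IsStationaryProcess μ X)
        (c₀ b : ℝ) (_ : 0 < c₀) (_ : 0 < b)
        (_ : IsGeomMixing F μ X c₀ b γ ∨ IsGeomMixingRev F μ X c₀ b γ)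
        -- the common distribution `P` of the `X_i`, with bounded density `f`, supported in `B_{r₀}`
        (P : Measure (Fin d → ℝ)) (_ : P = μ.map (fun ω => (X 1 ω : Fin d → ℝ)))
        (f : (Fin d → ℝ) → ℝ) (_ : Measurable f) (_ : ∀ x, 0 ≤ f x)
        (_ : P = volume.withDensity (fun x => ENNReal.ofReal (f x)))
        (_ : eLpNorm f ∞ volume < ∞)
        (r₀ : ℝ) (_ : 1 ≤ r₀) (_ : P {x | r₀ < N x} = 0)
        (h : ℝ) (_ : 0 < h) (_ : h ≤ 1) (τ : ℝ) (_ : 0 < τ)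
        (n : ℕ) (_ : nZeroStar d c₀ b γ h (φ h) (K 0) ≤ (n : ℝ)),
        1 - Real.exp (-τ) ≤ μ.real {ω |
          supNorm (fun x : Fin d → ℝ =>
              kSmoothing N K h (empiricalMeasure (fun i => (X i ω : Fin d → ℝ)) n) x
                - kSmoothing N K h P x)
            ≤ C * (Real.sqrt (lInftyNorm f * (τ + Real.log (n * r₀ / h))
                      * Real.log n ^ (2 / γ) / (h ^ d * n))
                + K 0 * (τ + Real.log (n * r₀ / h)) * Real.log n ^ (2 / γ) / (h ^ d * n))} := by
  obtain ⟨L, hL⟩ := hKβ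
  obtain ⟨a, ha, hcover⟩ := N.exists_finset_cover hN
  obtain ⟨c, hc, hKc⟩ := hK.exists_le_div hd
  have hcont := hL.continuousOn hβ0
  have hK0 := hK.pos_zero
  have hβ : (0 : ℝ) < β := hβ0
  set κ := ∫ y : Fin d → ℝ, K (N y) with hκdef
  have hκ : 0 < κ := hK.integral_pos
  -- Chosen so that the `T` below is at most `C₁ (τ + log W)`; the 2 covers `τ + 1 + log 2`.
  set C₁ : ℝ := 2 + d * Real.log (2 * a + 3) + d * (1 + 1 / β) with hC₁def
  have hlog0 : 0 ≤ Real.log (2 * a + 3) := Real.log_nonneg (by linarith)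
  have hC₁ : 0 ≤ C₁ := by positivity
  set C₂ : ℝ := 2 * L + c with hC₂def
  have hC₂ : 0 ≤ C₂ := by positivity
  set C₃ : ℝ := 2 ^ (1 / γ) + 1 with hC₃def
  have hC₃ : 0 < C₃ := by positivity
  refine ⟨2 * C₁ * C₃ + C₂ / K 0 + 2 * Real.sqrt (2 * C₁ * C₃ * K 0 * κ) + C₃, by positivity, ?_⟩
  intro Ω _ μ _ S F hF φ hφ X hX c₀ b hc₀ hb hmix P hPmap f _ hf0 hPf hf r₀ hr₀ hP h hh hh1 τ hτ n hn
  obtain ⟨hn3, -, -⟩ := of_nZeroStar_le hn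
  have hn3' : (3 : ℝ) ≤ n := by exact_mod_cast hn3
  have hn0 : (0 : ℝ) < n := by linarith
  have hD : 0 < h ^ d := by positivity
  have hXm : Measurable fun ω => (X 1 ω : Fin d → ℝ) :=
    measurable_subtype_coe.comp (hX.measurable 1 le_rfl)
  have hPprob : IsProbabilityMeasure P := by
    rw [hPmap]
    exact Measure.isProbabilityMeasure_map hXm.aemeasurable
  have hl : 1 ≤ Real.log n ^ (2 / γ) :=
    Real.one_le_rpow (one_le_log_of_three_le hn3') (by positivity)
  set l := Real.log n ^ (2 / γ) with hldef
  have hW3 : 3 ≤ n * r₀ / h := by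
    rw [le_div_iff₀ hh]
    nlinarith
  set W := n * r₀ / h with hWdef
  have hlogW := one_le_log_of_three_le hW3
  have hE : 1 ≤ τ + Real.log W := by linarith
  -- The gap satisfies `k^γ ≥ 2 (log n)²`. Rounding up costs at most `1 ≤ l`, hence the `+ 1` in
  -- `C₃`.
  set k : ℕ := ⌈(2 : ℝ) ^ (1 / γ) * l⌉₊ with hkdef
  have hkl : (2 : ℝ) ^ (1 / γ) * l ≤ k := Nat.le_ceil _
  have hk0 : (0 : ℝ) < k := lt_of_lt_of_le (by positivity) hkl
  have hk1 : 1 ≤ k := by exact_mod_cast hk0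
  have hku : (k : ℝ) ≤ C₃ * l := by
    have := Nat.ceil_lt_add_one (a := (2 : ℝ) ^ (1 / γ) * l) (by positivity)
    rw [hC₃def]
    linarith
  -- For `n < k` the Bernstein bound is unavailable, but `n ≤ C₃ l` makes the trivial bound `h^{-d}
  -- K(0)` enough.
  rcases lt_or_ge n k with hnk | hkn
  · have hnk' : (n : ℝ) ≤ C₃ * l := le_trans (by exact_mod_cast hnk.le) hku
    refine one_sub_le_measureReal_of_compl (B := ∅) (fun ω _ => ?_) (by
      rw [measureReal_empty]
      positivity)
    refine (supNorm_kSmoothing_sub_le_trivial hK hh n _ hcont).trans ?_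
    exact trivial_bound_le (C₁ := 2 * C₁ * C₃ + C₂ / K 0 + 2 * Real.sqrt (2 * C₁ * C₃ * K 0 * κ))
      hn0 hD hK0 (by positivity) hC₃.le le_rfl hE hl (Real.sqrt_nonneg _) hnk'
  have hη := mixing_remainder_le hc₀ hb hγ hh hh1 (hφ h hh).1 hK0 hn hkl
  have hρ := mixingCoeff_le_or_rev_le hmix hk1
  -- The mesh for which `(u / h)^β = 1 / n`.
  set u := h * (n : ℝ) ^ (-(1 / (β : ℝ))) with hudef
  have hu0 : 0 < u := by positivity
  have huβ : (u / h) ^ (β : ℝ) ≤ 1 / n := by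
    rw [hudef, mul_div_cancel_left₀ _ hh.ne', ← Real.rpow_mul hn0.le, neg_mul,
      one_div_mul_cancel hβ.ne', Real.rpow_neg_one, one_div]
  obtain ⟨Z, hZcard, hZ⟩ := hcover (r₀ + h * n) u (by positivity) hu0
  have hcard := cover_card_bound ha hβ hr₀ hh hh1 hn3' hZcard
  rw [← hWdef] at hcard
  set M := ((2 * a + 3) * W ^ (1 + 1 / (β : ℝ))) ^ d with hMdef
  have hM : 0 < M := by positivity
  have hlogM : Real.log M = d * Real.log (2 * a + 3) + d * (1 + 1 / β) * Real.log W := by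
    rw [hMdef, Real.log_pow, Real.log_mul (by positivity) (by positivity),
      Real.log_rpow (by positivity)]
    ring
  have hlogM0 : 0 ≤ Real.log M := by
    rw [hlogM]
    positivity
  have hlog2 : 0 ≤ Real.log 2 ∧ Real.log 2 ≤ 1 :=
    ⟨Real.log_nonneg (by norm_num), by linarith [Real.log_two_lt_d9]⟩
  -- Solves `M * 2 e^{1 - T} = e^{-τ}`, the union bound over at most `M` centres.
  set T := τ + 1 + Real.log 2 + Real.log M with hTdef
  have hT0 : 0 < T := by linarith [hlog2.1]
  have hT : T ≤ C₁ * (τ + Real.log W) := by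
    have e1 : d * Real.log (2 * a + 3) ≤ d * Real.log (2 * a + 3) * (τ + Real.log W) :=
      le_mul_of_one_le_right (by positivity) hE
    have e2 : d * (1 + 1 / (β : ℝ)) * Real.log W ≤ d * (1 + 1 / β) * (τ + Real.log W) := by
      gcongr
      linarith
    rw [hTdef, hlogM, hC₁def]
    linarith [hlog2.2]
  set V := K 0 * κ * lInftyNorm f * h ^ d with hVdef
  set ε := 2 * (T * k * K 0 + Real.sqrt (2 * n * k * V * T)) with hεdef
  have hε : 0 ≤ ε := by positivity
  set bad : (Fin d → ℝ) → Set Ω := fun z => {ω | ε ≤ |∑ i ∈ Finset.Icc 1 n,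
    (K (N (z - X i ω) / h) - ∫ y, K (N (z - y) / h) ∂P)|} with hbad
  -- The `X_i` lie in `B_{r₀}` only almost surely, so these null events join the exceptional set.
  set out : ℕ → Set Ω := fun i => {ω | r₀ < N (X i ω)} with hout
  have hbad_le : ∀ z, μ.real (bad z) ≤ 2 * Real.exp (1 - T) := fun z => by
    have := measureReal_kernel_deviation_le hK hcont hF hφ hX hρ hf0 (hPmap.symm.trans hPf) hf hh
      hT0 hk1 hkn hη z
    rw [← hPmap] at this
    exact this
  have hout_le : ∀ i ∈ Finset.Icc 1 n, μ.real (out i) = 0 := fun i hi => by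
    rw [measureReal_def, measure_exists_norm_gt_eq_zero hX (hPmap ▸ hP) (Finset.mem_Icc.1 hi).1]
    rfl
  refine one_sub_le_measureReal_of_compl
    (B := (⋃ z ∈ Z, bad z) ∪ ⋃ i ∈ Finset.Icc 1 n, out i) (fun ω hω => ?_) ?_
  · simp only [mem_compl_iff, mem_union, mem_iUnion, not_or, not_exists] at hω
    refine (supNorm_kSmoothing_sub_le hK hL hβ0 hc hKc hP hh (by omega)
      (fun i hi => not_lt.1 (hω.2 i hi)) huβ hZ hε fun z hz => (not_le.1 (hω.1 z hz)).le).trans ?_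
    exact deviation_bound_le hn0 hD hK0 hκ ENNReal.toReal_nonneg hC₁ hC₂ hC₃.le hE hl hT0.le hT
      hk0.le hku
  · calc _ ≤ ∑ z ∈ Z, μ.real (bad z) + ∑ i ∈ Finset.Icc 1 n, μ.real (out i) :=
          (measureReal_union_le _ _).trans (add_le_add (measureReal_biUnion_finset_le _ _)
            (measureReal_biUnion_finset_le _ _))
      _ ≤ ∑ z ∈ Z, 2 * Real.exp (1 - T) + 0 :=
          add_le_add (Finset.sum_le_sum fun z _ => hbad_le z) (Finset.sum_eq_zero hout_le).le
      _ = Z.card * (2 * Real.exp (1 - T)) := by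
          rw [Finset.sum_const, nsmul_eq_mul, add_zero]
      _ ≤ M * (2 * Real.exp (1 - T)) := by gcongr
      _ = Real.exp (-τ) := by
          have : (1 - T) = -τ - Real.log 2 - Real.log M := by rw [hTdef]; ring
          rw [this, Real.exp_sub, Real.exp_sub, Real.exp_log hM, Real.exp_log two_pos]
          field_simp
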